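/- Let $B_N=\{z\in\mathbb C^N:|z|<1\}$ and let $\varphi:B_N\to B_N$ be a linear fractional self-map, i.e. $\varphi(z)=\dfrac{Ez+f}{\langle z,g\rangle+h}$ with $E\in\mathbb C^{N\times N}$, $f,g\in\mathbb C^N$, $h\in\mathbb C$ and $\langle z,g\rangle+h\neq0$ on $B_N$ (inner products are linear in the first variable). Suppose that $\varphi$ is hyperbolic: it has no fixed point in $B_N$, and its boundary dilation coefficient $$\delta=\liminf_{z\to w}\frac{1-|\varphi(z)|^2}{1-|z|^2}$$ lies in $(0,1)$, where $w\in\partial B_N$ is the Denjoy–Wolff point of $\varphi$ (the point to which the iterates of $\varphi$ converge uniformly on compact subsets of $B_N$). Put $\lambda=1/\delta>1$. Then there are integers $p,q,r\ge0$ with $1+p+q+r=N$ (so some of the variables $u,v,w$ below may be absent), a number $b\in\mathbb C$, a vector $c\in\mathbb C^r$ and matrices $D\in\mathbb C^{q\times q}$, $A\in\mathbb C^{r\times r}$ such that $\varphi$ is conjugate to the self-map $$\psi(z,u,v,w)=(\lambda z+b,\ \sqrt\lambda\,u,\ \sqrt\lambda\,Dv,\ \sqrt\lambda\,Aw+c)$$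 of the Siegel half-plane $\mathbb H^N=\{(z,u,v,w)\in\mathbb C\times\mathbb C^p\times\mathbb C^q\times\mathbb C^r:\operatorname{Im}z>|u|^2+|v|^2+|w|^2\}$; that is, $\psi$ maps $\mathbb H^N$ into itself and $\psi=\sigma\circ\varphi\circ\sigma^{-1}$ for some biholomorphic map $\sigma:B_N\to\mathbb H^N$. Moreover: 1. $D$ is diagonal and its spectrum is contained in $\{\mu\in\mathbb C:|\mu|=1\}\setminus\{1\}$, while every eigenvalue of $A$ has modulus less than $1$; 2. both $Q=I-A^HA$ and $P=I-AA^H$ are Hermitian positive semidefinite; 3. $\operatorname{Im}b\ge\langle P^+c,c\rangle$, where $P^+$ is the (Moore–Penrose) pseudo-inverse of $P$; 4. $QQ^+A^Hc=A^Hc$, where $Q^+$ is the pseudo-inverse of $Q$. -/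

import Mathlib

open Filter Topology Set
open scoped Matrix ComplexOrder

/-- Complex Euclidean space `ℂ^n`. -/
abbrev CSpace (n : ℕ) : Type := EuclideanSpace ℂ (Fin n)

/-- The open unit ball `B_N` of `ℂ^N`. -/
def unitBall (N : ℕ) : Set (CSpace N) := Metric.ball 0 1

/-- The action of a square complex matrix on `ℂ^n`. -/
noncomputable def matVec {n : ℕ} (A : Matrix (Fin n) (Fin n) ℂ) (z : CSpace n) : CSpace n :=
  WithLp.toLp 2 (A *ᵥ z.ofLp)

/-- `φ ∈ LFT(B_N)`: a self-map of the ball of the form `z ↦ (A z + B) / (⟨z, C⟩ + D)`, the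
denominator having no zero in the ball. Here `⟨z, C⟩` is linear in `z`, which in Mathlib's
convention is `inner ℂ C z`. Only the values of `φ` on the ball matter. -/
def IsLFTBall {N : ℕ} (φ : CSpace N → CSpace N) : Prop :=
  MapsTo φ (unitBall N) (unitBall N) ∧
  ∃ (A : Matrix (Fin N) (Fin N) ℂ) (B C : CSpace N) (D : ℂ),
    ∀ z ∈ unitBall N, inner ℂ C z + D ≠ 0 ∧
      φ z = (inner ℂ C z + D)⁻¹ • (matVec A z + B)

/-- `w` is the Denjoy-Wolff point of `φ`: a point of the unit sphere to which the iterates of `φ`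
converge uniformly on compact subsets of the ball. -/
def IsDenjoyWolffPoint {N : ℕ} (φ : CSpace N → CSpace N) (w : CSpace N) : Prop :=
  ‖w‖ = 1 ∧ ∀ K ⊆ unitBall N, IsCompact K →
    TendstoUniformlyOn (fun n : ℕ => φ^[n]) (fun _ => w) atTop K

/-- `δ` is the boundary dilation coefficient of `φ`, that is,
`δ = liminf_{z → w} (1 - |φ(z)|²) / (1 - |z|²)` with `w` the Denjoy-Wolff point of `φ`
(the lower limit is taken over `z` in the ball, in the extended reals). -/
def HasBoundaryDilation {N : ℕ} (φ : CSpace N → CSpace N) (δ : ℝ) : Prop :=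
  ∃ w : CSpace N, IsDenjoyWolffPoint φ w ∧
    liminf (fun z : CSpace N => (((1 - ‖φ z‖ ^ 2) / (1 - ‖z‖ ^ 2) : ℝ) : EReal))
      (𝓝[unitBall N] w) = (δ : EReal)

/-- A self-map of the ball is hyperbolic if it has no fixed point in the ball and its boundary
dilation coefficient lies in `(0, 1)`. -/
def IsHyperbolicMap {N : ℕ} (φ : CSpace N → CSpace N) : Prop :=
  (∀ z ∈ unitBall N, φ z ≠ z) ∧ ∃ δ ∈ Ioo (0 : ℝ) 1, HasBoundaryDilation φ δ

/-- The Siegel half-plane `ℍ^N = {(z, W) ∈ ℂ × ℂ^(N-1) : Im z > |W|²}`, where `ℂ^(N-1)` is written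
as `ℂ^p × ℂ^q × ℂ^r` with `1 + p + q + r = N` and `W = (u, v, w)`. -/
def siegel (p q r : ℕ) : Set (ℂ × CSpace p × CSpace q × CSpace r) :=
  {x | ‖x.2.1‖ ^ 2 + ‖x.2.2.1‖ ^ 2 + ‖x.2.2.2‖ ^ 2 < x.1.im}

/-- The self-map `φ` of `U` and the self-map `ψ` of `V` are conjugate: `ψ = σ ∘ φ ∘ σ⁻¹` on `V` for
a biholomorphic map `σ` of `U` onto `V`, with inverse `τ`. -/
def AreConjugate {E F : Type*} [NormedAddCommGroup E] [NormedSpace ℂ E]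
    [NormedAddCommGroup F] [NormedSpace ℂ F]
    (φ : E → E) (U : Set E) (ψ : F → F) (V : Set F) : Prop :=
  ∃ (σ : E → F) (τ : F → E),
    DifferentiableOn ℂ σ U ∧ DifferentiableOn ℂ τ V ∧
    MapsTo σ U V ∧ MapsTo τ V U ∧ LeftInvOn τ σ U ∧ RightInvOn τ σ V ∧
    ∀ x ∈ V, ψ x = σ (φ (τ x))

/-- The map `(z, u, v, w) ↦ (ℓ z + b, √ℓ u, √ℓ D v, √ℓ A w + c)`. -/
noncomputable def hyperbolicForm {p q r : ℕ} (ℓ : ℝ) (b : ℂ) (D : Matrix (Fin q) (Fin q) ℂ)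
    (A : Matrix (Fin r) (Fin r) ℂ) (c : CSpace r) :
    ℂ × CSpace p × CSpace q × CSpace r → ℂ × CSpace p × CSpace q × CSpace r :=
  fun x => ((ℓ : ℂ) * x.1 + b, (√ℓ : ℂ) • x.2.1, (√ℓ : ℂ) • matVec D x.2.2.1,
    (√ℓ : ℂ) • matVec A x.2.2.2 + c)

/-- The four Penrose equations: `X` is the Moore-Penrose pseudo-inverse of `M`. -/
structure IsPseudoInverse {n : ℕ} (M X : Matrix (Fin n) (Fin n) ℂ) : Prop where
  mul_mul_left : M * X * M = M
  mul_mul_right : X * M * X = X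
  herm_left : (M * X).IsHermitian
  herm_right : (X * M).IsHermitian

theorem IsPseudoInverse.unique {n : ℕ} {M X Y : Matrix (Fin n) (Fin n) ℂ}
    (hX : IsPseudoInverse M X) (hY : IsPseudoInverse M Y) : X = Y := by
  have h1 : M * X = M * Y := by
    have e : (M * Y * (M * X))ᴴ = M * X * (M * Y) := by
      rw [Matrix.conjTranspose_mul, hX.herm_left.eq, hY.herm_left.eq]
    have e1 : M * Y * (M * X) = M * X := by rw [← mul_assoc, hY.mul_mul_left]
    have e2 : M * X * (M * Y) = M * Y := by rw [← mul_assoc, hX.mul_mul_left]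
    rw [e1, e2, hX.herm_left.eq] at e
    exact e
  have h2 : X * M = Y * M := by
    have e : (X * M * (Y * M))ᴴ = Y * M * (X * M) := by
      rw [Matrix.conjTranspose_mul, hX.herm_right.eq, hY.herm_right.eq]
    have e1 : X * M * (Y * M) = X * M := by rw [mul_assoc, ← mul_assoc M, hY.mul_mul_left]
    have e2 : Y * M * (X * M) = Y * M := by rw [mul_assoc, ← mul_assoc M, hX.mul_mul_left]
    rw [e1, e2, hX.herm_right.eq] at e
    exact e
  calc X = X * M * X := hX.mul_mul_right.symm
    _ = Y * (M * X) := by rw [h2, mul_assoc]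
    _ = Y := by rw [h1, ← mul_assoc, hY.mul_mul_right]

theorem exists_isPseudoInverse_of_isHermitian {n : ℕ} {H : Matrix (Fin n) (Fin n) ℂ}
    (hH : H.IsHermitian) :
    ∃ G, IsPseudoInverse H G ∧ G.IsHermitian ∧ H * G = G * H := by
  set U : Matrix (Fin n) (Fin n) ℂ := (hH.eigenvectorUnitary : Matrix (Fin n) (Fin n) ℂ) with hU
  have hUU : Uᴴ * U = 1 := Matrix.mem_unitaryGroup_iff'.mp hH.eigenvectorUnitary.2
  set d : Fin n → ℂ := fun i => (hH.eigenvalues i : ℂ) with hd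
  have hHd : H = U * Matrix.diagonal d * Uᴴ := by
    have h := hH.spectral_theorem
    rw [Unitary.conjStarAlgAut_apply] at h
    exact h
  have key : ∀ a b : Fin n → ℂ, (U * Matrix.diagonal a * Uᴴ) * (U * Matrix.diagonal b * Uᴴ)
      = U * Matrix.diagonal (fun i => a i * b i) * Uᴴ := by
    intro a b
    calc _ = U * Matrix.diagonal a * (Uᴴ * U) * Matrix.diagonal b * Uᴴ := by
          simp only [mul_assoc]
      _ = _ := by rw [hUU, mul_one, mul_assoc U, Matrix.diagonal_mul_diagonal]
  have herm : ∀ a : Fin n → ℝ, (U * Matrix.diagonal (fun i => (a i : ℂ)) * Uᴴ).IsHermitian := by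
    intro a
    rw [Matrix.IsHermitian, Matrix.conjTranspose_mul, Matrix.conjTranspose_mul,
      Matrix.conjTranspose_conjTranspose, Matrix.diagonal_conjTranspose, mul_assoc]
    congr 3
    ext i
    simp
  have c1 : (fun i => d i * (d i)⁻¹ : Fin n → ℂ)
      = fun i => ((hH.eigenvalues i * (hH.eigenvalues i)⁻¹ : ℝ) : ℂ) := by
    ext i; simp [hd]
  have c2 : (fun i => (d i)⁻¹ * d i : Fin n → ℂ)
      = fun i => ((hH.eigenvalues i * (hH.eigenvalues i)⁻¹ : ℝ) : ℂ) := by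
    ext i; simp [hd, mul_comm]
  have c3 : (fun i => (d i)⁻¹ : Fin n → ℂ)
      = fun i => (((hH.eigenvalues i)⁻¹ : ℝ) : ℂ) := by
    ext i; simp [hd]
  refine ⟨U * Matrix.diagonal (fun i => (d i)⁻¹) * Uᴴ, ⟨?_, ?_, ?_, ?_⟩, ?_, ?_⟩
  · rw [hHd, key, key]; simp
  · rw [hHd, key, key]
    have e : (fun i => (d i)⁻¹ * d i * (d i)⁻¹) = fun i => (d i)⁻¹ := by
      ext i
      by_cases h : d i = 0
      · simp [h]
      · field_simp
    rw [e]
  · rw [hHd, key, c1]; exact herm _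
  · rw [hHd, key, c2]; exact herm _
  · rw [c3]; exact herm _
  · rw [hHd, key, key, c1, c2]

theorem exists_isPseudoInverse {n : ℕ} (M : Matrix (Fin n) (Fin n) ℂ) :
    ∃ X, IsPseudoInverse M X := by
  obtain ⟨G, hG, hGh, hc⟩ :=
    exists_isPseudoInverse_of_isHermitian (Matrix.isHermitian_conjTranspose_mul_self M)
  have hHh : (Mᴴ * M)ᴴ = Mᴴ * M := (Matrix.isHermitian_conjTranspose_mul_self M).eq
  have h0 : M * (G * (Mᴴ * M)) - M = 0 := by
    rw [← Matrix.conjTranspose_mul_self_eq_zero, Matrix.conjTranspose_sub,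
      Matrix.conjTranspose_mul, Matrix.conjTranspose_mul, hHh, hGh.eq]
    have e : Mᴴ * M * (G * (Mᴴ * M)) = Mᴴ * M := by rw [← mul_assoc, hG.mul_mul_left]
    have e1 : Mᴴ * (M * (G * (Mᴴ * M)) - M) = 0 := by
      rw [mul_sub, ← mul_assoc Mᴴ M, e, sub_self]
    rw [sub_mul, mul_assoc (Mᴴ * M * G), e1, mul_zero, sub_zero]
  refine ⟨G * Mᴴ, ?_, ?_, ?_, ?_⟩
  · rw [sub_eq_zero] at h0
    simpa only [mul_assoc] using h0
  · have e := congrArg (· * Mᴴ) hG.mul_mul_right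
    simpa only [mul_assoc] using e
  · rw [Matrix.IsHermitian, Matrix.conjTranspose_mul, Matrix.conjTranspose_mul,
      Matrix.conjTranspose_conjTranspose, hGh.eq, mul_assoc]
  · rw [mul_assoc]; exact hG.herm_right

/-- The Moore-Penrose pseudo-inverse of a square complex matrix. -/
noncomputable def pseudoInv {n : ℕ} (M : Matrix (Fin n) (Fin n) ℂ) : Matrix (Fin n) (Fin n) ℂ :=
  (exists_isPseudoInverse M).choose

theorem isPseudoInverse_pseudoInv {n : ℕ} (M : Matrix (Fin n) (Fin n) ℂ) :
    IsPseudoInverse M (pseudoInv M) :=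
  (exists_isPseudoInverse M).choose_spec

/-! Send the Denjoy–Wolff point `w` to infinity. If the denominator `d` of `φ = F / d` vanished at
`w`, the bound `‖F‖ < ‖d‖` near `w` would make `φ` constant and give it a fixed point
(`denominator_ne_zero_of_mem_sphere`). So `φ` extends continuously to `w`, and an orbit converging
to `w` shows that `w` is fixed. The same bound, read along curves tangent to the sphere at `w`,
shows that `d - ⟨F, w⟩` is a multiple of `1 - ⟨z, w⟩` (`exists_denominator_sub_eq`). Hence `d`
cancels in the Cayley transform of `φ`, which is an affine self-map `(ζ, ω) ↦ (ℓζ + aω + b, Mω + c)`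
of the Siegel half-plane (`exists_affine_conjugate`). The defect `Im ζ - ‖ω‖²` gives `δ = 1/ℓ`
(`liminf_dilation_eq`).

Since `‖M‖ ≤ √ℓ < ℓ`, the operator `ℓ - M*` is invertible, and a Heisenberg translation removes `a`
(`exists_heisenberg_normalization`). What is left of the self-map property is `‖Mω + c‖² ≤ ℓ‖ω‖² +
Im b`, and the remaining conclusions come from it. It makes `T = M/√ℓ` a contraction. Unimodular
eigenvectors of a contraction are eigenvectors of the adjoint, so they split off orthogonally, and
`c` is orthogonal to them (`exists_block_normal_form`). On the remaining block, boundedness above of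
`‖Ax + c‖² - ‖x‖²` forces `Aᴴc` into the range of `Q`. At the critical point `Qx = Aᴴc` its value is
`⟨P⁺c, c⟩`, whence the bound on `Im b`. -/

/-! ### Affine self-maps of the Siegel half-plane -/

section Siegel

variable {E : Type*} [NormedAddCommGroup E] [InnerProductSpace ℂ E]

/-- The Siegel half-plane `{(ζ, ω) : Im ζ > |ω|²}` over a complex inner product space. -/
def siegelDomain (E : Type*) [NormedAddCommGroup E] : Set (ℂ × E) :=
  {x | ‖x.2‖ ^ 2 < x.1.im}

/-- A real number dominated by every small positive multiple of a constant is nonpositive. -/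
theorem nonpos_of_le_mul_small {x C ε : ℝ} (hε : 0 < ε)
    (h : ∀ s, 0 < s → s < ε → x ≤ s * C) : x ≤ 0 := by
  have ht : Tendsto (fun s : ℝ => s * C) (𝓝[>] 0) (𝓝 0) := by
    have : Continuous fun s : ℝ => s * C := by fun_prop
    simpa using (this.tendsto 0).mono_left nhdsWithin_le_nhds
  refine ge_of_tendsto ht ?_
  filter_upwards [Ioo_mem_nhdsGT hε] with s hs using h s hs.1 hs.2

/-- If `0 ≤ x t + y` for all `t > 0`, then `0 ≤ x`. -/
theorem nonneg_of_forall_pos_mul_add {x y : ℝ} (h : ∀ t, 0 < t → 0 ≤ x * t + y) : 0 ≤ x := by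
  by_contra! hx
  have h1 := h ((|y| + 1) / (-x)) (by have : 0 < -x := by linarith
                                      positivity)
  have h2 : x * ((|y| + 1) / (-x)) = -(|y| + 1) := by
    have : x ≠ 0 := hx.ne
    field_simp
  rw [h2] at h1
  linarith [le_abs_self y]

theorem eq_zero_of_forall_mul_add_nonneg {x y : ℝ} (h : ∀ t, 0 ≤ x * t + y) : x = 0 := by
  refine le_antisymm ?_ (nonneg_of_forall_pos_mul_add fun t _ => h t)
  have := nonneg_of_forall_pos_mul_add (x := -x) (y := y) fun t _ => by
    have := h (-t)
    linarith
  linarith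

theorem eq_zero_of_sq_le_linear {x C D : ℝ} (hx : 0 ≤ x)
    (h : ∀ t, 1 ≤ t → (x * t) ^ 2 ≤ C * t + D) : x = 0 := by
  by_contra hne
  have hx' : 0 < x := lt_of_le_of_ne hx (Ne.symm hne)
  have hm : 0 ≤ (|C| + |D| + 1) / x ^ 2 := by positivity
  have h1 := h ((|C| + |D| + 1) / x ^ 2 + 1) (by linarith)
  -- With this `t`, `x² t` exceeds `|C| + |D|`, so the quadratic side wins; the final `+ 1` secures
  -- `1 ≤ t`.
  set t := (|C| + |D| + 1) / x ^ 2 + 1 with ht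
  have ht1 : 1 ≤ t := by linarith
  have h2 : x ^ 2 * t = (|C| + |D| + 1) + x ^ 2 := by
    rw [ht]; field_simp
  have h3 : (x * t) ^ 2 = ((|C| + |D| + 1) + x ^ 2) * t := by rw [← h2]; ring
  rw [h3] at h1
  have h4 : C * t ≤ |C| * t := mul_le_mul_of_nonneg_right (le_abs_self C) (by linarith)
  have h5 : D ≤ |D| * t := by nlinarith [le_abs_self D, abs_nonneg D]
  have h6 : 0 < (1 + x ^ 2) * t := by positivity
  nlinarith

variable {ℓ₀ b : ℂ} {a : E →ₗ[ℂ] ℂ} {k c : E} {M : E →ₗ[ℂ] E}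

/-- An affine self-map of the Siegel half-plane has real nonnegative dilation, no `ζ`-dependence in
the second component, and satisfies a quadratic inequality. -/
theorem affine_selfMap_siegelDomain
    (h : ∀ ζ : ℂ, ∀ ω : E, ‖ω‖ ^ 2 < ζ.im →
      ‖ζ • k + M ω + c‖ ^ 2 < (ℓ₀ * ζ + a ω + b).im) :
    k = 0 ∧ ∃ ℓ : ℝ, 0 ≤ ℓ ∧ ℓ₀ = ℓ ∧
      ∀ ω : E, ‖M ω + c‖ ^ 2 ≤ ℓ * ‖ω‖ ^ 2 + (a ω).im + b.im := by
  have h0 : ∀ ζ : ℂ, 0 < ζ.im → ‖ζ • k + c‖ ^ 2 < (ℓ₀ * ζ).im + b.im := by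
    intro ζ hζ
    simpa using h ζ 0 (by simpa using hζ)
  have hre : ∀ t : ℝ, 0 < t → 0 ≤ ℓ₀.re * t + b.im := by
    intro t ht
    have := h0 (t * Complex.I) (by simpa using ht)
    simp at this
    nlinarith [sq_nonneg ‖((t : ℂ) * Complex.I) • k + c‖]
  -- Along the horizontal line `ζ = t + i` the lower bound is affine in `t ∈ ℝ` with slope `Im ℓ₀`.
  have him : ℓ₀.im = 0 := by
    refine eq_zero_of_forall_mul_add_nonneg (y := ℓ₀.re + b.im) fun t => ?_
    have := h0 (t + Complex.I) (by simp)
    simp at this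
    nlinarith [sq_nonneg ‖((t : ℂ) + Complex.I) • k + c‖]
  -- Along `ζ = it` the left side grows like `‖k‖² t²` and the right side only linearly. The factors
  -- 2 come from `(u + v)² ≤ 2u² + 2v²`.
  have hk : k = 0 := by
    rw [← norm_eq_zero]
    refine eq_zero_of_sq_le_linear (C := 2 * ℓ₀.re) (D := 2 * b.im + 2 * ‖c‖ ^ 2)
      (norm_nonneg _) fun t ht => ?_
    have h1 := h0 (t * Complex.I) (by simp; linarith)
    simp at h1
    have h2 : ‖((t : ℂ) * Complex.I) • k‖ = ‖k‖ * t := by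
      rw [norm_smul]; simp [abs_of_pos (show 0 < t by linarith)]; ring
    have h3 : ‖k‖ * t ≤ ‖((t : ℂ) * Complex.I) • k + c‖ + ‖c‖ := by
      rw [← h2]
      simpa using norm_sub_le (((t : ℂ) * Complex.I) • k + c) c
    have h4 : (‖k‖ * t) ^ 2 ≤ (‖((t : ℂ) * Complex.I) • k + c‖ + ‖c‖) ^ 2 :=
      pow_le_pow_left₀ (by positivity) h3 2
    nlinarith [sq_nonneg (‖((t : ℂ) * Complex.I) • k + c‖ - ‖c‖)]
  refine ⟨hk, ℓ₀.re, nonneg_of_forall_pos_mul_add hre, Complex.ext (by simp) (by simpa using him),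
    fun ω => ?_⟩
  -- Take `ζ = i(‖ω‖² + s)`, just above the boundary, and let `s → 0`.
  have key : ∀ s : ℝ, 0 < s → s < 1 →
      ‖M ω + c‖ ^ 2 - (ℓ₀.re * ‖ω‖ ^ 2 + (a ω).im + b.im) ≤ s * ℓ₀.re := by
    intro s hs _
    have := h (((‖ω‖ ^ 2 + s : ℝ) : ℂ) * Complex.I) ω (by
      simp only [Complex.mul_im, Complex.ofReal_re, Complex.I_im, Complex.ofReal_im, Complex.I_re]
      linarith)
    rw [hk, smul_zero, zero_add, Complex.add_im, Complex.add_im, Complex.mul_im, him] at this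
    simp only [Complex.mul_im, Complex.ofReal_re, Complex.I_im, Complex.ofReal_im,
      Complex.I_re] at this
    linarith
  linarith [nonpos_of_le_mul_small one_pos key]

/-- The linear part `M` of an affine self-map with dilation `ℓ` satisfies `‖M ω‖² ≤ ℓ ‖ω‖²`. -/
theorem norm_sq_linear_le {ℓ : ℝ}
    (h : ∀ ω : E, ‖M ω + c‖ ^ 2 ≤ ℓ * ‖ω‖ ^ 2 + (a ω).im + b.im) (ω : E) :
    ‖M ω‖ ^ 2 ≤ ℓ * ‖ω‖ ^ 2 := by
  rw [← sub_nonpos]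
  -- Apply the hypothesis to `ω / s` and multiply by `s²`: the lower-order terms become `O(s)`.
  refine nonpos_of_le_mul_small (C := (a ω).im + |b.im| + 2 * ‖M ω‖ * ‖c‖) one_pos fun s hs hs1 => ?_
  have h1 := h (((s⁻¹ : ℝ) : ℂ) • ω)
  have h2 : ‖M ω + (s : ℂ) • c‖ = s * ‖M (((s⁻¹ : ℝ) : ℂ) • ω) + c‖ := by
    rw [← Real.norm_of_nonneg hs.le, ← Complex.norm_real, ← norm_smul, map_smul, smul_add,
      smul_smul, Complex.norm_real, Real.norm_of_nonneg hs.le, ← Complex.ofReal_mul,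
      mul_inv_cancel₀ hs.ne', Complex.ofReal_one, one_smul]
  have h3 : ‖M ω‖ - s * ‖c‖ ≤ ‖M ω + (s : ℂ) • c‖ := by
    have := norm_sub_norm_le (M ω) (-((s : ℂ) • c))
    rw [norm_neg, norm_smul, Complex.norm_real, Real.norm_of_nonneg hs.le, sub_neg_eq_add] at this
    exact this
  have h4 : ‖M ω‖ ^ 2 - 2 * s * (‖M ω‖ * ‖c‖) ≤ ‖M ω + (s : ℂ) • c‖ ^ 2 := by
    by_cases h5 : s * ‖c‖ ≤ ‖M ω‖
    · nlinarith [pow_le_pow_left₀ (sub_nonneg.2 h5) h3 2, sq_nonneg (s * ‖c‖)]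
    · nlinarith [sq_nonneg ‖M ω + (s : ℂ) • c‖, norm_nonneg (M ω)]
  have h6 : (a (((s⁻¹ : ℝ) : ℂ) • ω)).im = s⁻¹ * (a ω).im := by
    rw [map_smul, smul_eq_mul, Complex.im_ofReal_mul]
  rw [h6, norm_smul, Complex.norm_real, Real.norm_of_nonneg (by positivity)] at h1
  have h7 := mul_le_mul_of_nonneg_left h1 (sq_nonneg s)
  rw [← mul_pow, ← h2] at h7
  have h8 : s ^ 2 * (ℓ * (s⁻¹ * ‖ω‖) ^ 2 + s⁻¹ * (a ω).im + b.im)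
      = ℓ * ‖ω‖ ^ 2 + s * (a ω).im + s ^ 2 * b.im := by
    field_simp
  have h9 : s ^ 2 * b.im ≤ s * |b.im| := by
    nlinarith [le_abs_self b.im, abs_nonneg b.im, mul_le_mul_of_nonneg_left (le_abs_self b.im)
      (sq_nonneg s), mul_nonneg (mul_nonneg hs.le (sub_nonneg.2 hs1.le)) (abs_nonneg b.im)]
  rw [h8] at h7
  linarith

end Siegel

/-! ### Heisenberg translations and removal of the linear term -/

section Heisenberg

variable {E : Type*} [NormedAddCommGroup E] [InnerProductSpace ℂ E]

/-- The Heisenberg translation of `ℂ × E` by `γ`, an automorphism of the Siegel half-plane. -/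
noncomputable def heisenberg (γ : E) (x : ℂ × E) : ℂ × E :=
  (x.1 + 2 * Complex.I * inner ℂ γ x.2 + Complex.I * (‖γ‖ ^ 2 : ℝ), x.2 + γ)

/-- The two extra terms in the first component have imaginary parts `2 Re ⟨γ, ω⟩` and `‖γ‖²`,
exactly the growth of `‖ω + γ‖²`. -/
theorem heisenberg_defect (γ : E) (x : ℂ × E) :
    (heisenberg γ x).1.im - ‖(heisenberg γ x).2‖ ^ 2 = x.1.im - ‖x.2‖ ^ 2 := by
  have h : ‖x.2 + γ‖ ^ 2 = ‖x.2‖ ^ 2 + 2 * (inner ℂ γ x.2).re + ‖γ‖ ^ 2 := by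
    have h1 : (inner ℂ x.2 γ).re = (inner ℂ γ x.2).re := by
      rw [← inner_conj_symm, Complex.conj_re]
    rw [@norm_add_sq ℂ, RCLike.re_to_complex, h1]
  simp only [heisenberg, h, Complex.add_im, Complex.mul_im, Complex.I_re, Complex.I_im,
    Complex.ofReal_re, Complex.ofReal_im, Complex.mul_re, Complex.re_ofNat, Complex.im_ofNat]
  ring

theorem heisenberg_mem_iff (γ : E) (x : ℂ × E) :
    heisenberg γ x ∈ siegelDomain E ↔ x ∈ siegelDomain E := by
  simp only [siegelDomain, mem_ofPred_eq]
  have := heisenberg_defect γ x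
  constructor <;> intro h <;> linarith

theorem heisenberg_neg_heisenberg (γ : E) (x : ℂ × E) :
    heisenberg (-γ) (heisenberg γ x) = x := by
  have h : inner ℂ γ γ = ((‖γ‖ ^ 2 : ℝ) : ℂ) := by
    rw [inner_self_eq_norm_sq_to_K]; norm_cast
  ext
  · simp only [heisenberg, inner_neg_left, inner_add_right, norm_neg, h]
    ring
  · simp [heisenberg]

theorem heisenberg_heisenberg_neg (γ : E) (x : ℂ × E) :
    heisenberg γ (heisenberg (-γ) x) = x := by
  simpa using heisenberg_neg_heisenberg (-γ) x

theorem differentiable_heisenberg (γ : E) : Differentiable ℂ (heisenberg γ) := by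
  have h : Differentiable ℂ fun x : ℂ × E => inner ℂ γ x.2 :=
    (innerSL ℂ γ).differentiable.comp differentiable_snd
  unfold heisenberg
  fun_prop

/-- A kernel vector would satisfy `ℓ‖γ‖² ≤ ‖Mγ‖‖γ‖ ≤ √ℓ‖γ‖²`, which is impossible for `γ ≠ 0`
because `ℓ > 1`. This is where hyperbolicity makes the normalization possible. -/
theorem surjective_smul_sub_adjoint [FiniteDimensional ℂ E] {M : E →ₗ[ℂ] E} {ℓ : ℝ} (hℓ : 1 < ℓ)
    (hM : ∀ ω, ‖M ω‖ ^ 2 ≤ ℓ * ‖ω‖ ^ 2) (α : E) :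
    ∃ γ : E, (ℓ : ℂ) • γ - LinearMap.adjoint M γ = α := by
  have hinj : Function.Injective ((ℓ : ℂ) • LinearMap.id - LinearMap.adjoint M : E →ₗ[ℂ] E) := by
    rw [injective_iff_map_eq_zero]
    intro γ hγ
    have h1 : (ℓ : ℂ) • γ = LinearMap.adjoint M γ := by
      simpa [sub_eq_zero] using hγ
    have h2 : ℓ * ‖γ‖ ^ 2 ≤ ‖M γ‖ * ‖γ‖ := by
      have h3 : inner ℂ ((ℓ : ℂ) • γ) γ = inner ℂ γ (M γ) := by
        rw [h1, LinearMap.adjoint_inner_left]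
      have h4 := congrArg norm h3
      rw [inner_smul_left, norm_mul, inner_self_eq_norm_sq_to_K] at h4
      simp only [Complex.conj_ofReal, Complex.norm_real, Complex.coe_algebraMap, norm_pow,
        Real.norm_eq_abs, abs_norm, abs_of_pos (show 0 < ℓ by linarith)] at h4
      rw [h4]
      exact (norm_inner_le_norm _ _).trans_eq (mul_comm _ _)
    have h5 : (ℓ * ‖γ‖ ^ 2) ^ 2 ≤ ℓ * ‖γ‖ ^ 2 * ‖γ‖ ^ 2 := by
      calc (ℓ * ‖γ‖ ^ 2) ^ 2 ≤ (‖M γ‖ * ‖γ‖) ^ 2 := pow_le_pow_left₀ (by positivity) h2 2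
        _ = ‖M γ‖ ^ 2 * ‖γ‖ ^ 2 := by ring
        _ ≤ _ := mul_le_mul_of_nonneg_right (hM γ) (by positivity)
    by_contra hne
    have h6 : 0 < (‖γ‖ ^ 2) ^ 2 := by positivity
    have h7 : 0 < ℓ * (ℓ - 1) * (‖γ‖ ^ 2) ^ 2 :=
      mul_pos (mul_pos (by linarith) (by linarith)) h6
    nlinarith
  obtain ⟨γ, hγ⟩ := (LinearMap.injective_iff_surjective.1 hinj) α
  exact ⟨γ, by simpa using hγ⟩

/-- A Heisenberg translation removes the linear term from the first component of an affine
self-map of the Siegel half-plane. -/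
theorem exists_heisenberg_normalization [FiniteDimensional ℂ E] {ℓ : ℝ} (hℓ : 1 < ℓ) {b : ℂ}
    {a : E →ₗ[ℂ] ℂ} {c : E} {M : E →ₗ[ℂ] E}
    (h : ∀ ζ : ℂ, ∀ ω : E, ‖ω‖ ^ 2 < ζ.im → ‖M ω + c‖ ^ 2 < (ℓ * ζ + a ω + b).im) :
    ∃ (γ : E) (b' : ℂ) (c' : E),
      (∀ x : ℂ × E, (ℓ * (heisenberg γ x).1 + a (heisenberg γ x).2 + b,
        M (heisenberg γ x).2 + c) = heisenberg γ (ℓ * x.1 + b', M x.2 + c')) ∧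
      ∀ ω : E, ‖M ω + c'‖ ^ 2 ≤ ℓ * ‖ω‖ ^ 2 + b'.im := by
  have h' : ∀ ω : E, ‖M ω + c‖ ^ 2 ≤ ℓ * ‖ω‖ ^ 2 + (a ω).im + b.im := by
    obtain ⟨_, ℓ', _, h2, h3⟩ := affine_selfMap_siegelDomain (k := (0 : E)) (ℓ₀ := ℓ) (b := b)
      (a := a) (M := M) (c := c) (by simpa using h)
    obtain rfl : ℓ = ℓ' := by exact_mod_cast h2
    exact h3
  set α := (InnerProductSpace.toDual ℂ E).symm (LinearMap.toContinuousLinearMap a) with hα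
  have ha : ∀ ω, a ω = inner ℂ α ω := fun ω => by simp [hα]
  -- Comparing the terms linear in `ω` in the conjugation identity gives `key`, that is `(ℓ - M*)γ =
  -- -(i/2)α`; the scalar is conjugated in the first slot of the inner product.
  obtain ⟨γ, hγ⟩ := surjective_smul_sub_adjoint hℓ (norm_sq_linear_le h') ((-(Complex.I / 2)) • α)
  have key : ∀ ω, 2 * Complex.I * ℓ * inner ℂ γ ω + a ω = 2 * Complex.I * inner ℂ γ (M ω) := by
    intro ω
    have := congrArg (fun v => inner ℂ v ω) hγ
    simp only [inner_sub_left, inner_smul_left, LinearMap.adjoint_inner_left, map_neg, map_div₀,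
      Complex.conj_I, Complex.conj_ofReal, Complex.conj_ofNat, ← ha] at this
    linear_combination (2 * Complex.I) * this + a ω * Complex.I_sq
  -- `c'` and `b'` are forced by the constant terms of the conjugation identity.
  set c' := M γ + c - γ with hc'
  set b' := Complex.I * ℓ * (‖γ‖ ^ 2 : ℝ) + a γ + b - 2 * Complex.I * inner ℂ γ c'
    - Complex.I * (‖γ‖ ^ 2 : ℝ) with hb'
  have hconj : ∀ x : ℂ × E, (ℓ * (heisenberg γ x).1 + a (heisenberg γ x).2 + b,
        M (heisenberg γ x).2 + c) = heisenberg γ (ℓ * x.1 + b', M x.2 + c') := by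
    intro x
    ext
    · simp only [heisenberg, map_add, inner_add_right, hb']
      linear_combination key x.2
    · simp only [heisenberg, map_add, hc']
      abel
  refine ⟨γ, b', c', hconj, ?_⟩
  obtain ⟨_, ℓ', _, h2, h3⟩ := affine_selfMap_siegelDomain (k := (0 : E)) (ℓ₀ := ℓ) (b := b')
      (a := 0) (M := M) (c := c') (by
        intro ζ ω hω
        have h1 := (heisenberg_mem_iff γ (ζ, ω)).2 hω
        have h2 := h _ _ h1
        have h3 := (heisenberg_mem_iff γ (ℓ * ζ + b', M ω + c')).1 (by
          rw [← hconj (ζ, ω)]; exact h2)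
        simpa [siegelDomain] using h3)
  obtain rfl : ℓ = ℓ' := by exact_mod_cast h2
  simpa using h3

end Heisenberg

/-! ### Unimodular eigenvectors of contractions -/

section Contraction

variable {E : Type*} [NormedAddCommGroup E] [InnerProductSpace ℂ E] [FiniteDimensional ℂ E]

theorem norm_adjoint_apply_le {T : E →ₗ[ℂ] E} (hT : ∀ x, ‖T x‖ ≤ ‖x‖) (x : E) :
    ‖LinearMap.adjoint T x‖ ≤ ‖x‖ := by
  by_contra! hlt
  have h : ‖LinearMap.adjoint T x‖ ^ 2 ≤ ‖x‖ * ‖LinearMap.adjoint T x‖ := by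
    have h1 : inner ℂ (LinearMap.adjoint T x) (LinearMap.adjoint T x)
        = inner ℂ x (T (LinearMap.adjoint T x)) := LinearMap.adjoint_inner_left _ _ _
    have h2 := congrArg norm h1
    rw [inner_self_eq_norm_sq_to_K] at h2
    simp only [Complex.coe_algebraMap, norm_pow, Complex.norm_real, norm_norm] at h2
    rw [h2]
    exact (norm_inner_le_norm _ _).trans (mul_le_mul_of_nonneg_left (hT _) (norm_nonneg _))
  nlinarith [norm_nonneg x]

/-- A unimodular eigenvector of a contraction is an eigenvector of the adjoint. -/
theorem adjoint_apply_of_unimodular {T : E →ₗ[ℂ] E} (hT : ∀ x, ‖T x‖ ≤ ‖x‖) {x : E} {μ : ℂ}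
    (hμ : ‖μ‖ = 1) (hx : T x = μ • x) :
    LinearMap.adjoint T x = (starRingEnd ℂ μ) • x := by
  -- Expand `‖T*x - μ̄x‖² = ‖T*x‖² - 2‖x‖² + ‖x‖²`, which is nonpositive since `T*` is a
  -- contraction.
  rw [← sub_eq_zero, ← norm_eq_zero, ← sq_eq_zero_iff]
  refine le_antisymm ?_ (sq_nonneg _)
  have h1 : inner ℂ (LinearMap.adjoint T x) ((starRingEnd ℂ μ) • x) = ((‖x‖ ^ 2 : ℝ) : ℂ) := by
    rw [LinearMap.adjoint_inner_left, map_smul, hx, smul_smul, mul_comm, Complex.mul_conj,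
      Complex.normSq_eq_norm_sq, hμ, inner_smul_right, inner_self_eq_norm_sq_to_K]
    simp
  rw [@norm_sub_sq ℂ, h1, norm_smul, RCLike.norm_conj, hμ]
  have h2 := pow_le_pow_left₀ (norm_nonneg _) (norm_adjoint_apply_le hT x) 2
  simp only [RCLike.re_to_complex, Complex.ofReal_re]
  linarith

/-- A contraction of a finite-dimensional space has a maximal orthonormal family of unimodular
eigenvectors: every eigenvector orthogonal to it has an eigenvalue of modulus less than one. -/
theorem exists_maximal_unimodular_family {T : E →ₗ[ℂ] E} (hT : ∀ x, ‖T x‖ ≤ ‖x‖) :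
    ∃ (n : ℕ) (v : Fin n → E) (μ : Fin n → ℂ), Orthonormal ℂ v ∧ (∀ i, ‖μ i‖ = 1) ∧
      (∀ i, T (v i) = μ i • v i) ∧
      ∀ (x : E) (ν : ℂ), x ≠ 0 → (∀ i, inner ℂ (v i) x = 0) → T x = ν • x → ‖ν‖ < 1 := by
  classical
  let P : ℕ → Prop := fun n => ∃ (v : Fin n → E) (μ : Fin n → ℂ), Orthonormal ℂ v ∧
    (∀ i, ‖μ i‖ = 1) ∧ ∀ i, T (v i) = μ i • v i
  have hP0 : P 0 := ⟨Fin.elim0, Fin.elim0, by constructor <;> intro i <;> exact i.elim0,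
    fun i => i.elim0, fun i => i.elim0⟩
  have hPle : ∀ n, P n → n ≤ Module.finrank ℂ E := by
    rintro n ⟨v, -, hv, -⟩
    simpa using hv.linearIndependent.fintype_card_le_finrank
  -- At the greatest size, another unimodular eigenvector orthogonal to the family could be
  -- normalized and added, a contradiction.
  set n := Nat.findGreatest P (Module.finrank ℂ E) with hn
  obtain ⟨v, μ, hv, hμ, hTv⟩ : P n := Nat.findGreatest_spec (Nat.zero_le _) hP0
  refine ⟨n, v, μ, hv, hμ, hTv, fun x ν hx hvx hxν => ?_⟩
  have hle : ‖ν‖ ≤ 1 := by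
    have h := hT x
    rw [hxν, norm_smul] at h
    exact le_of_mul_le_mul_right (by simpa using h) (norm_pos_iff.2 hx)
  refine lt_of_le_of_ne hle fun hν => ?_
  have hPn : P (n + 1) := by
    have hxn : ‖((‖x‖ : ℂ)⁻¹ • x)‖ = 1 := norm_smul_inv_norm hx
    refine ⟨Fin.cons ((‖x‖ : ℂ)⁻¹ • x) v, Fin.cons ν μ, ?_, ?_, ?_⟩
    · rw [orthonormal_iff_ite] at hv ⊢
      intro i j
      refine Fin.cases ?_ (fun i => ?_) i <;> refine Fin.cases ?_ (fun j => ?_) j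
      · simp only [Fin.cons_zero, inner_self_eq_norm_sq_to_K, hxn]
        simp
      · have : inner ℂ x (v j) = 0 := inner_eq_zero_symm.1 (hvx j)
        simp [inner_smul_left, this, (Fin.succ_ne_zero j).symm]
      · simp [inner_smul_right, hvx i]
      · simpa using hv i j
    · intro i
      refine Fin.cases ?_ (fun i => ?_) i
      · simpa using hν
      · simpa using hμ i
    · intro i
      refine Fin.cases ?_ (fun i => ?_) i
      · simp [hxν, smul_smul, mul_comm]
      · simpa using hTv i
  have := Nat.le_findGreatest (hPle _ hPn) hPn
  omega

/-- Splitting of a contraction of a finite-dimensional space: in a suitable orthonormal basis it is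
the direct sum of an identity, a diagonal unitary without eigenvalue `1`, and a matrix whose
eigenvalues have modulus less than one. -/
theorem exists_orthonormalBasis_splitting {T : E →ₗ[ℂ] E} (hT : ∀ x, ‖T x‖ ≤ ‖x‖) :
    ∃ (p q r : ℕ) (B : OrthonormalBasis (Fin p ⊕ Fin q ⊕ Fin r) ℂ E) (μ : Fin q → ℂ),
      (∀ i, T (B (.inl i)) = B (.inl i)) ∧
      (∀ i, T (B (.inr (.inl i))) = μ i • B (.inr (.inl i))) ∧
      (∀ i, ‖μ i‖ = 1 ∧ μ i ≠ 1) ∧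
      ∀ (x : E) (ν : ℂ), x ≠ 0 → (∀ i, inner ℂ (B (.inl i)) x = 0) →
        (∀ i, inner ℂ (B (.inr (.inl i))) x = 0) → T x = ν • x → ‖ν‖ < 1 := by
  classical
  obtain ⟨n, v, μ, hv, hμ, hTv, hmax⟩ := exists_maximal_unimodular_family hT
  set W := (Submodule.span ℂ (Set.range v))ᗮ with hW
  set g := stdOrthonormalBasis ℂ W
  set e₁ := Fintype.equivFin {i // μ i = 1}
  set e₂ := Fintype.equivFin {i // ¬ μ i = 1}
  -- The maximal family, sorted by whether `μ i = 1`, is completed by an orthonormal basis of its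
  -- orthogonal complement.
  set f : Fin (Fintype.card {i // μ i = 1}) ⊕ Fin (Fintype.card {i // ¬ μ i = 1}) ⊕
      Fin (Module.finrank ℂ W) → E :=
    Sum.elim (fun i => v (e₁.symm i)) (Sum.elim (fun i => v (e₂.symm i)) fun i => (g i : E)) with hf
  have hvW : ∀ i (y : W), inner ℂ (v i) (y : E) = 0 := fun i y =>
    (Submodule.mem_orthogonal _ _).1 y.2 _ (Submodule.subset_span ⟨i, rfl⟩)
  have hWv : ∀ i (y : W), inner ℂ (y : E) (v i) = 0 := fun i y =>
    inner_eq_zero_symm.1 (hvW i y)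
  have hon : Orthonormal ℂ f := by
    have hg := g.orthonormal
    rw [orthonormal_iff_ite] at hv hg ⊢
    have h12 : ∀ (i : {i // μ i = 1}) (j : {i // ¬ μ i = 1}), (i : Fin n) ≠ j :=
      fun i j h => j.2 (h ▸ i.2)
    rintro (i | i | i) (j | j | j)
    · simp [hf, hv, ← Subtype.ext_iff]
    · simp [hf, hv, h12]
    · simp [hf, hvW]
    · simp [hf, hv, (h12 _ _).symm]
    · simp [hf, hv, ← Subtype.ext_iff]
    · simp [hf, hvW]
    · simp [hf, hWv]
    · simp [hf, hWv]
    · simpa [hf] using hg i j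
  have hspan : (Submodule.span ℂ (Set.range f))ᗮ = ⊥ := by
    rw [Submodule.eq_bot_iff]
    intro y hy
    have hy' : ∀ i, inner ℂ (f i) y = 0 := fun i =>
      (Submodule.mem_orthogonal _ _).1 hy _ (Submodule.subset_span ⟨i, rfl⟩)
    have hyW : y ∈ W := by
      rw [hW, Submodule.mem_orthogonal]
      intro u hu
      induction hu using Submodule.span_induction with
      | mem x hx =>
        obtain ⟨i, rfl⟩ := hx
        by_cases h : μ i = 1
        · simpa [hf] using hy' (.inl (e₁ ⟨i, h⟩))
        · simpa [hf] using hy' (.inr (.inl (e₂ ⟨i, h⟩)))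
      | zero => simp
      | add x z _ _ h1 h2 => simp [inner_add_left, h1, h2]
      | smul a x _ h1 => simp [inner_smul_left, h1]
    have : (⟨y, hyW⟩ : W) = 0 := by
      refine g.repr.map_eq_zero_iff.1 ?_
      ext i
      simpa [hf, g.repr_apply_apply] using hy' (.inr (.inr i))
    simpa using congrArg Subtype.val this
  have hB : ⇑(OrthonormalBasis.mkOfOrthogonalEqBot hon hspan) = f := by simp
  refine ⟨_, _, _, OrthonormalBasis.mkOfOrthogonalEqBot hon hspan, fun i => μ (e₂.symm i),
    ?_, ?_, ?_, ?_⟩ <;> simp only [hB]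
  · intro i
    simp [hf, hTv, (e₁.symm i).2]
  · intro i
    simp [hf, hTv]
  · exact fun i => ⟨hμ _, (e₂.symm i).2⟩
  · intro x ν hx h1 h2
    refine hmax x ν hx fun i => ?_
    by_cases h : μ i = 1
    · simpa [hf] using h1 (e₁ ⟨i, h⟩)
    · simpa [hf] using h2 (e₂ ⟨i, h⟩)

end Contraction

/-! ### Behaviour of a linear fractional map at the Denjoy–Wolff point -/

section BoundaryPoint

variable {V : Type*} [NormedAddCommGroup V] [InnerProductSpace ℂ V]

theorem inner_unit_self {w : V} (hw : ‖w‖ = 1) : inner ℂ w w = (1 : ℂ) := by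
  rw [inner_self_eq_norm_sq_to_K, hw]; simp

theorem inner_smul_add_proj {w : V} (hw : ‖w‖ = 1) (z : V) :
    (inner ℂ w z : ℂ) • w + ((ℂ ∙ w)ᗮ.orthogonalProjectionOnto z : V) = z := by
  have h := Submodule.starProjection_add_starProjection_orthogonal (K := ℂ ∙ w) z
  rwa [Submodule.starProjection_unit_singleton ℂ hw] at h

theorem inner_unit_orthogonal {w : V} (y : (ℂ ∙ w)ᗮ) : inner ℂ w (y : V) = 0 :=
  Submodule.mem_orthogonal_singleton_iff_inner_right.1 y.2

theorem norm_sq_smul_add {w : V} (hw : ‖w‖ = 1) (a : ℂ) (y : (ℂ ∙ w)ᗮ) :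
    ‖a • w + (y : V)‖ ^ 2 = ‖a‖ ^ 2 + ‖y‖ ^ 2 := by
  rw [@norm_add_sq ℂ, inner_smul_left, inner_unit_orthogonal, norm_smul, hw]
  simp

theorem norm_sq_eq_inner_add_proj {w : V} (hw : ‖w‖ = 1) (z : V) :
    ‖z‖ ^ 2 = ‖inner ℂ w z‖ ^ 2 + ‖(ℂ ∙ w)ᗮ.orthogonalProjectionOnto z‖ ^ 2 := by
  conv_lhs => rw [← inner_smul_add_proj hw z]
  exact norm_sq_smul_add hw _ _

/-- These curves reach `w` tangentially: the displacement along `y` is of order `s`, the radial one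
only of order `s²`. Letting `s → 0` thus isolates the behaviour of affine functions in complex
tangential directions. -/
theorem smul_add_mem_ball {w : V} (hw : ‖w‖ = 1) {s : ℝ} (y : (ℂ ∙ w)ᗮ) (hs : 0 < s)
    (hs' : s < (1 + ‖y‖ ^ 2)⁻¹) :
    ((1 - s ^ 2 * (1 + ‖y‖ ^ 2) : ℝ) : ℂ) • w + (s : ℂ) • (y : V) ∈ Metric.ball (0 : V) 1 := by
  have hm : 0 < 1 + ‖y‖ ^ 2 := by positivity
  have h1 : s * (1 + ‖y‖ ^ 2) < 1 := by
    rwa [lt_inv_comm₀ hs hm, ← one_div, lt_div_iff₀ hs, mul_comm] at hs'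
  have h2 : ‖((1 - s ^ 2 * (1 + ‖y‖ ^ 2) : ℝ) : ℂ) • w + (((s : ℂ) • y : (ℂ ∙ w)ᗮ) : V)‖ ^ 2 < 1 := by
    rw [norm_sq_smul_add hw, Complex.norm_real, norm_smul, Complex.norm_real, Real.norm_eq_abs,
      Real.norm_eq_abs, sq_abs, mul_pow, sq_abs]
    have h3 : s ^ 2 * (1 + ‖y‖ ^ 2) < 1 := by nlinarith
    have h4 : 0 < s ^ 2 * (1 + ‖y‖ ^ 2) := by positivity
    nlinarith [mul_pos h4 (sub_pos.2 h3), sq_pos_of_pos hs]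
  rw [mem_ball_zero_iff]
  have := (sq_lt_one_iff₀ (norm_nonneg _)).1 h2
  simpa using this

theorem norm_numerator_le {φ L : V → V} {d : V → ℂ} {z : V}
    (hz : ‖φ z‖ < 1) (hd : d z ≠ 0) (hφ : φ z = (d z)⁻¹ • L z) : ‖L z‖ < ‖d z‖ := by
  rw [hφ, norm_smul, norm_inv, inv_mul_lt_iff₀ (norm_pos_iff.2 hd), mul_one] at hz
  exact hz

/-- A linear fractional self-map of the ball without fixed points has no pole on the sphere. -/
theorem denominator_ne_zero_of_mem_sphere {φ : V → V} {L : V →ₗ[ℂ] V} {B C : V} {D : ℂ}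
    (hmap : MapsTo φ (Metric.ball 0 1) (Metric.ball 0 1))
    (hden : ∀ z ∈ Metric.ball (0 : V) 1, inner ℂ C z + D ≠ 0)
    (hφ : ∀ z ∈ Metric.ball (0 : V) 1, φ z = (inner ℂ C z + D)⁻¹ • (L z + B))
    (hfix : ∀ z ∈ Metric.ball (0 : V) 1, φ z ≠ z) {w : V} (hw : ‖w‖ = 1) :
    inner ℂ C w + D ≠ 0 := by
  intro hdw
  set κ : ℂ := inner ℂ C w with hκ
  have hD : D = -κ := by linear_combination hdw
  have hd : ∀ z, inner ℂ C z + D = (inner ℂ w z - 1) * κ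
      + inner ℂ C ((ℂ ∙ w)ᗮ.orthogonalProjectionOnto z : V) := by
    intro z
    conv_lhs => rw [← inner_smul_add_proj hw z]
    rw [inner_add_right, inner_smul_right, hD]
    ring
  have hbound : ∀ z ∈ Metric.ball (0 : V) 1, ‖L z + B‖ < ‖inner ℂ C z + D‖ := fun z hz =>
    norm_numerator_le (L := fun z => L z + B) (d := fun z => inner ℂ C z + D)
      (by simpa using hmap hz) (hden z hz) (hφ z hz)
  -- Otherwise rescale `y` to `x` with `⟨x, C⟩ = κ`; the denominator then vanishes at `(1 - t)w +
  -- tx`, whose squared norm is `1 - t` for `t = 1/(1 + ‖x‖²)`.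
  have hC : ∀ y : (ℂ ∙ w)ᗮ, inner ℂ C (y : V) = 0 := by
    intro y
    by_contra hη
    set x : (ℂ ∙ w)ᗮ := (κ / inner ℂ C (y : V)) • y with hx
    have hCx : inner ℂ C (x : V) = κ := by
      simp [hx, hη]
    set t : ℝ := (1 + ‖x‖ ^ 2)⁻¹ with ht
    have ht0 : 0 < t := by positivity
    have htx : t * (1 + ‖x‖ ^ 2) = 1 := inv_mul_cancel₀ (by positivity)
    have hball : ((1 - t : ℝ) : ℂ) • w + (((t : ℂ) • x : (ℂ ∙ w)ᗮ) : V) ∈ Metric.ball (0 : V) 1 := by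
      rw [mem_ball_zero_iff, ← sq_lt_one_iff₀ (norm_nonneg _), norm_sq_smul_add hw,
        Complex.norm_real, norm_smul, Complex.norm_real, Real.norm_eq_abs,
        Real.norm_eq_abs, sq_abs, mul_pow, sq_abs]
      nlinarith [sq_nonneg ‖x‖]
    refine hden _ hball ?_
    rw [inner_add_right, inner_smul_right, Submodule.coe_smul, inner_smul_right, hCx, hD, ← hκ]
    push_cast
    ring
  have hκ0 : κ ≠ 0 := by
    intro h
    refine hden 0 (by simp) ?_
    simp [hD, h]
  have hds : ∀ (s : ℝ) (y : (ℂ ∙ w)ᗮ), inner ℂ C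
      (((1 - s ^ 2 * (1 + ‖y‖ ^ 2) : ℝ) : ℂ) • w + (s : ℂ) • (y : V)) + D
      = -((s ^ 2 * (1 + ‖y‖ ^ 2) : ℝ) : ℂ) * κ := by
    intro s y
    rw [inner_add_right, inner_smul_right, inner_smul_right, hC, hD, ← hκ]
    push_cast
    ring
  -- On the tangential curves the denominator is `O(s²)`, hence so is the numerator; its
  -- coefficients of order `1` and `s` must vanish.
  have hnum : ∀ (s : ℝ) (y : (ℂ ∙ w)ᗮ), 0 < s → s < (1 + ‖y‖ ^ 2)⁻¹ →
      ‖(L w + B) + (s : ℂ) • L y‖ ≤ s ^ 2 * ((1 + ‖y‖ ^ 2) * (‖κ‖ + ‖L w‖)) := by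
    intro s y hs hs'
    have h1 := hbound _ (smul_add_mem_ball hw y hs hs')
    have h0 : (0 : ℝ) ≤ s ^ 2 * (1 + ‖y‖ ^ 2) := by positivity
    rw [hds, norm_mul, norm_neg, Complex.norm_real, Real.norm_of_nonneg h0] at h1
    have h2 : (L w + B) + (s : ℂ) • L y = (L (((1 - s ^ 2 * (1 + ‖y‖ ^ 2) : ℝ) : ℂ) • w
        + (s : ℂ) • (y : V)) + B) + ((s ^ 2 * (1 + ‖y‖ ^ 2) : ℝ) : ℂ) • L w := by
      rw [map_add, map_smul, map_smul, Complex.ofReal_sub, sub_smul, Complex.ofReal_one, one_smul]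
      abel
    rw [h2]
    refine (norm_add_le _ _).trans ?_
    rw [norm_smul, Complex.norm_real, Real.norm_of_nonneg h0]
    linarith
  have hLw : L w + B = 0 := by
    rw [← norm_le_zero_iff]
    refine nonpos_of_le_mul_small (C := ‖κ‖ + ‖L w‖) one_pos fun s hs hs1 => ?_
    have := hnum s 0 hs (by simpa using hs1)
    simp at this
    refine this.trans (mul_le_mul_of_nonneg_right ?_ (by positivity))
    nlinarith
  have hLy : ∀ y : (ℂ ∙ w)ᗮ, L (y : V) = 0 := by
    intro y
    rw [← norm_le_zero_iff]
    refine nonpos_of_le_mul_small (C := (1 + ‖y‖ ^ 2) * (‖κ‖ + ‖L w‖))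
      (ε := (1 + ‖y‖ ^ 2)⁻¹) (by positivity) fun s hs hs1 => ?_
    have := hnum s y hs hs1
    rw [hLw, zero_add, norm_smul, Complex.norm_real, Real.norm_of_nonneg hs.le] at this
    refine le_of_mul_le_mul_left ?_ hs
    linarith
  -- Numerator and denominator are both multiples of `⟨z, w⟩ - 1`, so `φ` is constant and fixes its
  -- value.
  have hconst : ∀ z ∈ Metric.ball (0 : V) 1, φ z = κ⁻¹ • L w := by
    intro z hz
    have h1 : L z + B = (inner ℂ w z - 1) • L w := by
      conv_lhs => rw [← inner_smul_add_proj hw z]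
      rw [map_add, map_smul, hLy, add_zero, sub_smul, one_smul, eq_neg_of_add_eq_zero_right hLw]
      abel
    have h2 := hden z hz
    rw [hφ z hz, h1, hd z, hC, add_zero, smul_smul]
    rw [hd z, hC, add_zero] at h2
    have h3 : inner ℂ w z - 1 ≠ 0 := left_ne_zero_of_mul h2
    congr 1
    field_simp
  have h0 : κ⁻¹ • L w ∈ Metric.ball (0 : V) 1 := by
    rw [← hconst 0 (by simp)]
    exact hmap (by simp)
  exact hfix _ h0 (hconst _ h0)

/-- At a limit of an orbit where the denominator does not vanish, the linear fractional map fixes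
the limit. -/
theorem numerator_eq_of_tendsto_iterate [FiniteDimensional ℂ V]
    {φ : V → V} {L : V →ₗ[ℂ] V} {B C : V} {D : ℂ}
    (hmap : MapsTo φ (Metric.ball 0 1) (Metric.ball 0 1))
    (hφ : ∀ z ∈ Metric.ball (0 : V) 1, φ z = (inner ℂ C z + D)⁻¹ • (L z + B)) {w : V}
    (hlim : Tendsto (fun n => φ^[n] 0) atTop (𝓝 w)) (hdw : inner ℂ C w + D ≠ 0) :
    L w + B = (inner ℂ C w + D) • w := by
  have hmem : ∀ n, φ^[n] 0 ∈ Metric.ball (0 : V) 1 := fun n => hmap.iterate n (by simp)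
  have hL : Continuous L := L.continuous_of_finiteDimensional
  have h1 : Tendsto (fun n => (inner ℂ C (φ^[n] 0) + D)⁻¹ • (L (φ^[n] 0) + B)) atTop
      (𝓝 ((inner ℂ C w + D)⁻¹ • (L w + B))) := by
    refine Tendsto.smul (Tendsto.inv₀ ?_ hdw) ?_
    · exact ((continuous_const.inner continuous_id).tendsto w |>.comp hlim).add_const D
    · exact ((hL.tendsto w).comp hlim).add_const B
  have h2 : Tendsto (fun n => φ^[n + 1] 0) atTop (𝓝 w) := (tendsto_add_atTop_iff_nat 1).2 hlim
  have h3 := tendsto_nhds_unique (h2.congr fun n => by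
    rw [Function.iterate_succ_apply', hφ _ (hmem n)]) h1
  exact (inv_smul_eq_iff₀ hdw).1 h3.symm

/-- The affine function `d - ⟨F, w⟩` of a linear fractional self-map `F / d` of the ball fixing the
boundary point `w` is a nonzero multiple of `1 - ⟨z, w⟩`. -/
theorem exists_denominator_sub_eq {φ : V → V} {L : V →ₗ[ℂ] V} {B C : V} {D : ℂ}
    (hmap : MapsTo φ (Metric.ball 0 1) (Metric.ball 0 1))
    (hden : ∀ z ∈ Metric.ball (0 : V) 1, inner ℂ C z + D ≠ 0)
    (hφ : ∀ z ∈ Metric.ball (0 : V) 1, φ z = (inner ℂ C z + D)⁻¹ • (L z + B))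
    {w : V} (hw : ‖w‖ = 1) (hdw : inner ℂ C w + D ≠ 0)
    (hFw : L w + B = (inner ℂ C w + D) • w) :
    ∃ α : ℂ, α ≠ 0 ∧ ∀ z, inner ℂ C z + D - inner ℂ w (L z + B) = α * (1 - inner ℂ w z) := by
  set G : V → ℂ := fun z => inner ℂ C z - inner ℂ w (L z) with hG
  set d : V → ℂ := fun z => inner ℂ C z + D with hd
  have hGadd : ∀ x y, G (x + y) = G x + G y := fun x y => by
    simp only [hG, map_add, inner_add_right]; ring
  have hGsmul : ∀ (a : ℂ) x, G (a • x) = a * G x := fun a x => by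
    simp only [hG, map_smul, inner_smul_right]; ring
  have hGd : ∀ z, inner ℂ C z + D - inner ℂ w (L z + B) = G z - G w := by
    intro z
    have h : inner ℂ w (L w + B) = inner ℂ C w + D := by
      rw [hFw, inner_smul_right, inner_unit_self hw, mul_one]
    rw [inner_add_right] at h ⊢
    simp only [hG]
    linear_combination -h
  -- With `g = G z - G w = d - ⟨F, w⟩`, the bound `|d - g| < |d|` expands to `2 Re(d̄ g) > |g|²`.
  have hpos : ∀ z ∈ Metric.ball (0 : V) 1, 0 < (starRingEnd ℂ (d z) * (G z - G w)).re := by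
    intro z hz
    have h1 : ‖inner ℂ w (L z + B)‖ < ‖d z‖ := by
      refine lt_of_le_of_lt ?_ (norm_numerator_le (L := fun z => L z + B) (d := d)
        (by simpa using hmap hz) (hden z hz) (hφ z hz))
      exact (norm_inner_le_norm _ _).trans_eq (by rw [hw, one_mul])
    have h2 : inner ℂ w (L z + B) = d z - (G z - G w) := by rw [← hGd]; simp [hd]
    rw [h2] at h1
    have h3 := pow_lt_pow_left₀ h1 (norm_nonneg _) two_ne_zero
    rw [← Complex.normSq_eq_norm_sq, ← Complex.normSq_eq_norm_sq, Complex.normSq_sub] at h3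
    have h4 : (d z * starRingEnd ℂ (G z - G w)).re = (starRingEnd ℂ (d z) * (G z - G w)).re := by
      simp [Complex.mul_re]
      ring
    rw [h4] at h3
    linarith [Complex.normSq_nonneg (G z - G w)]
  -- Evaluate `hpos` on the tangential curve, divide by `s` and let `s → 0`. Replacing `y` by `-y`
  -- and `±iy` will then give `G y = 0`.
  have hre : ∀ y : (ℂ ∙ w)ᗮ, 0 ≤ (starRingEnd ℂ (d w) * G y).re := by
    intro y
    have hcont : Continuous fun s : ℝ => (starRingEnd ℂ
        (((1 - s ^ 2 * (1 + ‖y‖ ^ 2) : ℝ) : ℂ) * inner ℂ C w + s * inner ℂ C (y : V) + D)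
        * (G y - (s : ℂ) * (1 + ‖y‖ ^ 2 : ℝ) * G w)).re := by
      refine Complex.continuous_re.comp (Continuous.mul (Complex.continuous_conj.comp ?_) ?_) <;>
      fun_prop
    have ht := (hcont.tendsto 0).mono_left (nhdsWithin_le_nhds (s := Ioi (0 : ℝ)))
    have h0 : (starRingEnd ℂ (d w) * G y).re = (starRingEnd ℂ
        (((1 - (0 : ℝ) ^ 2 * (1 + ‖y‖ ^ 2) : ℝ) : ℂ) * inner ℂ C w + (0 : ℝ) * inner ℂ C (y : V) + D)
        * (G y - ((0 : ℝ) : ℂ) * (1 + ‖y‖ ^ 2 : ℝ) * G w)).re := by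
      simp [hd]
    rw [h0]
    refine ge_of_tendsto ht ?_
    filter_upwards [Ioo_mem_nhdsGT (show (0 : ℝ) < (1 + ‖y‖ ^ 2)⁻¹ by positivity)] with s hs
    have h1 := hpos _ (smul_add_mem_ball hw y hs.1 hs.2)
    have h2 : G (((1 - s ^ 2 * (1 + ‖y‖ ^ 2) : ℝ) : ℂ) • w + (s : ℂ) • (y : V)) - G w
        = s * (G y - (s : ℂ) * (1 + ‖y‖ ^ 2 : ℝ) * G w) := by
      rw [hGadd, hGsmul, hGsmul]
      push_cast
      ring
    have h3 : d (((1 - s ^ 2 * (1 + ‖y‖ ^ 2) : ℝ) : ℂ) • w + (s : ℂ) • (y : V))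
        = ((1 - s ^ 2 * (1 + ‖y‖ ^ 2) : ℝ) : ℂ) * inner ℂ C w + s * inner ℂ C (y : V) + D := by
      simp only [hd, inner_add_right, inner_smul_right]
    rw [h2, h3, mul_left_comm, Complex.re_ofReal_mul] at h1
    exact (pos_of_mul_pos_right h1 hs.1.le).le
  have hzero : ∀ y : (ℂ ∙ w)ᗮ, G y = 0 := by
    intro y
    have h : starRingEnd ℂ (d w) * G y = 0 := by
      have h1 := hre y
      have h2 := hre ((-1 : ℂ) • y)
      have h3 := hre (Complex.I • y)
      have h4 := hre ((-Complex.I) • y)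
      rw [Submodule.coe_smul, hGsmul, mul_left_comm] at h2 h3 h4
      set c := starRingEnd ℂ (d w) * G y
      simp at h2 h3 h4
      exact Complex.ext (by simp; linarith) (by simp; linarith)
    exact (mul_eq_zero.1 h).resolve_left (by simpa using hdw)
  refine ⟨-G w, ?_, fun z => ?_⟩
  · intro h
    have h1 := hpos 0 (by simp)
    have h2 : G 0 = 0 := by simp [hG]
    rw [h2, neg_eq_zero.1 h] at h1
    simp at h1
  · rw [hGd]
    have h := hGadd ((inner ℂ w z : ℂ) • w) ((ℂ ∙ w)ᗮ.orthogonalProjectionOnto z : V)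
    rw [inner_smul_add_proj hw, hGsmul, hzero] at h
    rw [h]
    ring

end BoundaryPoint

/-! ### The Cayley transform -/

section Cayley

variable {V : Type*} [NormedAddCommGroup V] [InnerProductSpace ℂ V]

/-- The Cayley transform of the unit ball onto the Siegel half-plane sending the unit vector `w` to
infinity. -/
noncomputable def cayley (w z : V) : ℂ × (ℂ ∙ w)ᗮ :=
  (Complex.I * (1 + inner ℂ w z) / (1 - inner ℂ w z),
    (Complex.I / (1 - inner ℂ w z)) • (ℂ ∙ w)ᗮ.orthogonalProjectionOnto z)

/-- The inverse of the Cayley transform. -/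
noncomputable def cayleyInv (w : V) (x : ℂ × (ℂ ∙ w)ᗮ) : V :=
  ((x.1 - Complex.I) / (x.1 + Complex.I)) • w + ((2 / (x.1 + Complex.I)) • x.2 : (ℂ ∙ w)ᗮ)

theorem one_sub_inner_ne_zero {w z : V} (hw : ‖w‖ = 1) (hz : z ∈ Metric.ball (0 : V) 1) :
    1 - inner ℂ w z ≠ 0 := by
  intro h
  have h1 : inner ℂ w z = 1 := (sub_eq_zero.1 h).symm
  have h2 := norm_inner_le_norm (𝕜 := ℂ) w z
  rw [h1, hw, norm_one, one_mul] at h2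
  exact absurd (mem_ball_zero_iff.1 hz) (not_lt.2 h2)

/-- This identity matches the ball with the half-plane and computes dilation quotients. Membership
of `z` in the ball is not assumed, so it can also prove that membership in `cayleyInv_mem_ball`. -/
theorem cayley_defect {w z : V} (hw : ‖w‖ = 1) (hz : 1 - inner ℂ w z ≠ 0) :
    1 - ‖z‖ ^ 2 = ‖1 - inner ℂ w z‖ ^ 2 * ((cayley w z).1.im - ‖(cayley w z).2‖ ^ 2) := by
  have hn : Complex.normSq (1 - inner ℂ w z) ≠ 0 := by simpa [Complex.normSq_eq_zero] using hz
  have h2 : ‖(cayley w z).2‖ ^ 2 * Complex.normSq (1 - inner ℂ w z)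
      = ‖(ℂ ∙ w)ᗮ.orthogonalProjectionOnto z‖ ^ 2 := by
    simp only [cayley]
    rw [norm_smul, norm_div, Complex.norm_I, mul_pow, div_pow, ← Complex.normSq_eq_norm_sq]
    field_simp
  have h1 : (cayley w z).1.im * Complex.normSq (1 - inner ℂ w z)
      = 1 - ‖inner ℂ w z‖ ^ 2 := by
    simp only [cayley]
    rw [Complex.div_im, ← Complex.normSq_eq_norm_sq]
    field_simp
    simp [Complex.normSq_apply]
    ring
  rw [norm_sq_eq_inner_add_proj hw z, ← Complex.normSq_eq_norm_sq (1 - inner ℂ w z)]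
  linarith

theorem cayley_mem_siegelDomain {w z : V} (hw : ‖w‖ = 1) (hz : z ∈ Metric.ball (0 : V) 1) :
    cayley w z ∈ siegelDomain (ℂ ∙ w)ᗮ := by
  have h := one_sub_inner_ne_zero hw hz
  have h1 := cayley_defect hw h
  have h2 : ‖z‖ ^ 2 < 1 := (sq_lt_one_iff₀ (norm_nonneg _)).2 (mem_ball_zero_iff.1 hz)
  rw [siegelDomain, mem_ofPred_eq, ← sub_pos]
  exact pos_of_mul_pos_right (h1 ▸ sub_pos.2 h2) (sq_nonneg _)

theorem add_I_ne_zero_of_im_pos {ζ : ℂ} (h : 0 < ζ.im) : ζ + Complex.I ≠ 0 := by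
  intro h0
  have := congrArg Complex.im h0
  simp at this
  linarith

theorem inner_cayleyInv {w : V} (hw : ‖w‖ = 1) (x : ℂ × (ℂ ∙ w)ᗮ) :
    inner ℂ w (cayleyInv w x) = (x.1 - Complex.I) / (x.1 + Complex.I) := by
  rw [cayleyInv, inner_add_right, inner_smul_right, inner_unit_self hw, inner_unit_orthogonal]
  ring

theorem proj_cayleyInv {w : V} (x : ℂ × (ℂ ∙ w)ᗮ) :
    (ℂ ∙ w)ᗮ.orthogonalProjectionOnto (cayleyInv w x) = (2 / (x.1 + Complex.I)) • x.2 := by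
  have h : (ℂ ∙ w)ᗮ.orthogonalProjectionOnto w = 0 :=
    Submodule.orthogonalProjectionOnto_apply_of_mem_orthogonal
      (Submodule.le_orthogonal_orthogonal _ (Submodule.mem_span_singleton_self w))
  rw [cayleyInv, map_add, map_smul, h, smul_zero, zero_add,
    Submodule.orthogonalProjectionOnto_mem_subspace_eq_self]

theorem cayley_cayleyInv {w : V} (hw : ‖w‖ = 1) {x : ℂ × (ℂ ∙ w)ᗮ} (hx : 0 < x.1.im) :
    cayley w (cayleyInv w x) = x := by
  have h := add_I_ne_zero_of_im_pos hx
  have h1 : 1 - (x.1 - Complex.I) / (x.1 + Complex.I)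
      = 2 * Complex.I / (x.1 + Complex.I) := by
    field_simp; ring
  ext1
  · simp only [cayley, inner_cayleyInv hw, h1]
    field_simp
    ring
  · simp only [cayley, inner_cayleyInv hw, proj_cayleyInv, h1, smul_smul]
    rw [show Complex.I / (2 * Complex.I / (x.1 + Complex.I)) * (2 / (x.1 + Complex.I)) = 1 by
      field_simp, one_smul]

theorem cayleyInv_cayley {w z : V} (hw : ‖w‖ = 1) (hz : z ∈ Metric.ball (0 : V) 1) :
    cayleyInv w (cayley w z) = z := by
  have h := one_sub_inner_ne_zero hw hz
  have h1 : Complex.I * (1 + inner ℂ w z) / (1 - inner ℂ w z) + Complex.I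
      = 2 * Complex.I / (1 - inner ℂ w z) := by
    field_simp; ring
  have h2 : Complex.I * (1 + inner ℂ w z) / (1 - inner ℂ w z) - Complex.I
      = 2 * Complex.I * inner ℂ w z / (1 - inner ℂ w z) := by
    field_simp; ring
  simp only [cayleyInv, cayley, h1, h2, smul_smul]
  conv_rhs => rw [← inner_smul_add_proj hw z]
  rw [show 2 / (2 * Complex.I / (1 - inner ℂ w z)) * (Complex.I / (1 - inner ℂ w z)) = 1 by
    field_simp, one_smul]
  congr 2
  field_simp

theorem cayleyInv_mem_ball {w : V} (hw : ‖w‖ = 1) {x : ℂ × (ℂ ∙ w)ᗮ}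
    (hx : x ∈ siegelDomain (ℂ ∙ w)ᗮ) : cayleyInv w x ∈ Metric.ball (0 : V) 1 := by
  have hx' : ‖x.2‖ ^ 2 < x.1.im := hx
  have him : 0 < x.1.im := lt_of_le_of_lt (sq_nonneg _) hx'
  have h := add_I_ne_zero_of_im_pos him
  have h1 : 1 - inner ℂ w (cayleyInv w x) ≠ 0 := by
    have h2 : 1 - (x.1 - Complex.I) / (x.1 + Complex.I)
        = 2 * Complex.I / (x.1 + Complex.I) := by
      field_simp; ring
    rw [inner_cayleyInv hw, h2]
    exact div_ne_zero (mul_ne_zero two_ne_zero Complex.I_ne_zero) h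
  have h2 := cayley_defect hw h1
  rw [cayley_cayleyInv hw him] at h2
  have h3 : 0 < ‖1 - inner ℂ w (cayleyInv w x)‖ ^ 2 * (x.1.im - ‖x.2‖ ^ 2) :=
    mul_pos (by positivity) (sub_pos.2 hx')
  rw [mem_ball_zero_iff, ← sq_lt_one_iff₀ (norm_nonneg _)]
  linarith

theorem differentiableOn_cayley {w : V} (hw : ‖w‖ = 1) :
    DifferentiableOn ℂ (cayley w) (Metric.ball 0 1) := by
  have h : Differentiable ℂ fun z : V => inner ℂ w z := (innerSL ℂ w).differentiable
  have hP : Differentiable ℂ fun z : V => (ℂ ∙ w)ᗮ.orthogonalProjectionOnto z :=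
    ((ℂ ∙ w)ᗮ.orthogonalProjectionOnto).differentiable
  intro z hz
  have hz' := one_sub_inner_ne_zero hw hz
  refine DifferentiableAt.differentiableWithinAt ?_
  have hinv : DifferentiableAt ℂ (fun z : V => (1 - inner ℂ w z)⁻¹) z :=
    ((h z).const_sub 1).fun_inv hz'
  unfold cayley
  simp only [div_eq_mul_inv]
  refine DifferentiableAt.prodMk ?_ ?_
  · exact ((h z).const_add 1 |>.const_mul _).fun_mul hinv
  · exact ((differentiableAt_const _).fun_mul hinv).fun_smul (hP z)

theorem differentiableOn_cayleyInv (w : V) :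
    DifferentiableOn ℂ (cayleyInv w) (siegelDomain (ℂ ∙ w)ᗮ) := by
  intro x hx
  have hx' := add_I_ne_zero_of_im_pos (lt_of_le_of_lt (sq_nonneg _) (show ‖x.2‖ ^ 2 < x.1.im from hx))
  refine DifferentiableAt.differentiableWithinAt ?_
  have hs : DifferentiableAt ℂ (fun x : ℂ × (ℂ ∙ w)ᗮ => (x.2 : V)) x :=
    ((ℂ ∙ w)ᗮ.subtypeL.differentiable.comp differentiable_snd) x
  have hinv : DifferentiableAt ℂ (fun x : ℂ × (ℂ ∙ w)ᗮ => (x.1 + Complex.I)⁻¹) x :=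
    (differentiableAt_fst.add_const Complex.I).fun_inv hx'
  unfold cayleyInv
  simp only [Submodule.coe_smul, div_eq_mul_inv]
  refine DifferentiableAt.add ?_ ?_
  · exact ((differentiableAt_fst.sub_const _).fun_mul hinv).smul_const w
  · exact ((differentiableAt_const _).fun_mul hinv).fun_smul hs

/-- An affine function of the ball variable, divided by `1 - ⟨z, w⟩`, is affine in the Siegel
variables. -/
theorem inv_smul_affine_eq {X : Type*} [AddCommGroup X] [Module ℂ X] {w z : V} (hw : ‖w‖ = 1)
    (hz : 1 - inner ℂ w z ≠ 0) (P : V →ₗ[ℂ] X) (Q : X) :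
    (1 - inner ℂ w z)⁻¹ • (P z + Q) = (cayley w z).1 • ((-(Complex.I / 2)) • (P w + Q))
      + (-Complex.I) • P ((cayley w z).2 : V) + (1 / 2 : ℂ) • (Q - P w) := by
  -- With `u = ⟨z, w⟩`: `1/(1 - u) = (1 - iζ)/2`, `u/(1 - u) = (-iζ - 1)/2`, and the tangential part
  -- of `z` over `1 - u` is `-iω`.
  have h1 : (-Complex.I) • P ((cayley w z).2 : V)
      = (1 - inner ℂ w z)⁻¹ • P ((ℂ ∙ w)ᗮ.orthogonalProjectionOnto z : V) := by
    simp only [cayley, Submodule.coe_smul, map_smul, smul_smul]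
    congr 1
    field_simp
    simp
  have h2 : (cayley w z).1 * (-(Complex.I / 2)) = (1 + inner ℂ w z) / (1 - inner ℂ w z) / 2 := by
    simp only [cayley]
    field_simp
    simp
  have h3 : P z = inner ℂ w z • P w + P ((ℂ ∙ w)ᗮ.orthogonalProjectionOnto z : V) := by
    conv_lhs => rw [← inner_smul_add_proj hw z]
    rw [map_add, map_smul]
  rw [h1, smul_smul, h2, h3]
  match_scalars
  · field_simp; ring
  · field_simp
  · field_simp; ring

end Cayley

/-! ### The affine conjugate and its dilation -/

section AffineConjugate

variable {V : Type*} [NormedAddCommGroup V] [InnerProductSpace ℂ V]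

/-- A linear fractional self-map of the ball fixing the boundary point `w` becomes an affine
self-map of the Siegel half-plane after the Cayley transform. -/
theorem exists_affine_conjugate {φ : V → V} {L : V →ₗ[ℂ] V} {B C : V} {D : ℂ}
    (hmap : MapsTo φ (Metric.ball 0 1) (Metric.ball 0 1))
    (hden : ∀ z ∈ Metric.ball (0 : V) 1, inner ℂ C z + D ≠ 0)
    (hφ : ∀ z ∈ Metric.ball (0 : V) 1, φ z = (inner ℂ C z + D)⁻¹ • (L z + B))
    {w : V} (hw : ‖w‖ = 1) (hdw : inner ℂ C w + D ≠ 0)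
    (hFw : L w + B = (inner ℂ C w + D) • w) :
    ∃ (ℓ : ℝ) (α b : ℂ) (a : (ℂ ∙ w)ᗮ →ₗ[ℂ] ℂ) (M : (ℂ ∙ w)ᗮ →ₗ[ℂ] (ℂ ∙ w)ᗮ) (c : (ℂ ∙ w)ᗮ),
      0 < ℓ ∧ α ≠ 0 ∧ inner ℂ C w + D = ℓ * α ∧
      (∀ z ∈ Metric.ball (0 : V) 1, 1 - inner ℂ w (φ z)
        = α * (1 - inner ℂ w z) / (inner ℂ C z + D)) ∧
      (∀ z ∈ Metric.ball (0 : V) 1, cayley w (φ z)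
        = (ℓ * (cayley w z).1 + a (cayley w z).2 + b, M (cayley w z).2 + c)) ∧
      ∀ ζ : ℂ, ∀ ω : (ℂ ∙ w)ᗮ, ‖ω‖ ^ 2 < ζ.im → ‖M ω + c‖ ^ 2 < (ℓ * ζ + a ω + b).im := by
  obtain ⟨α, hα, hG⟩ := exists_denominator_sub_eq hmap hden hφ hw hdw hFw
  have h1φ : ∀ z ∈ Metric.ball (0 : V) 1, 1 - inner ℂ w (φ z)
        = α * (1 - inner ℂ w z) / (inner ℂ C z + D) := by
    intro z hz
    have h := hden z hz
    rw [hφ z hz, inner_smul_right, ← hG]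
    field_simp
  set Pr := ((ℂ ∙ w)ᗮ.orthogonalProjectionOnto : V →ₗ[ℂ] (ℂ ∙ w)ᗮ) with hPr
  -- `P₁` and `P₂` are the linear parts of `d + ⟨F, w⟩` and of the projection of `F`. By `h1φ` the
  -- factor `d` cancels, so the Cayley coordinates of `φ z` are these affine functions times `i /
  -- (α(1 - ⟨z, w⟩))`.
  set P₁ : V →ₗ[ℂ] ℂ := (innerSL ℂ C : V →ₗ[ℂ] ℂ) + (innerSL ℂ w : V →ₗ[ℂ] ℂ) ∘ₗ L with hP₁
  set P₂ : V →ₗ[ℂ] (ℂ ∙ w)ᗮ := Pr ∘ₗ L with hP₂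
  set ℓ₀ : ℂ := (inner ℂ C w + D) / α with hℓ₀
  set a : (ℂ ∙ w)ᗮ →ₗ[ℂ] ℂ := (1 / α) • (P₁ ∘ₗ (ℂ ∙ w)ᗮ.subtype) with ha
  set b : ℂ := Complex.I / α * (1 / 2) * (D + inner ℂ w B - P₁ w) with hb
  set k : (ℂ ∙ w)ᗮ := (1 / (2 * α)) • (P₂ w + Pr B) with hk
  set M : (ℂ ∙ w)ᗮ →ₗ[ℂ] (ℂ ∙ w)ᗮ := (1 / α) • (P₂ ∘ₗ (ℂ ∙ w)ᗮ.subtype) with hM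
  set c : (ℂ ∙ w)ᗮ := (Complex.I / α * (1 / 2)) • (Pr B - P₂ w) with hc
  have hP₁w : P₁ w + (D + inner ℂ w B) = 2 * (inner ℂ C w + D) := by
    have := congrArg (inner ℂ w) hFw
    rw [inner_add_right, inner_smul_right, inner_unit_self hw] at this
    simp [hP₁]
    linear_combination this
  have hconj : ∀ z ∈ Metric.ball (0 : V) 1, cayley w (φ z)
      = (ℓ₀ * (cayley w z).1 + a (cayley w z).2 + b,
        (cayley w z).1 • k + M (cayley w z).2 + c) := by
    intro z hz
    have hz1 := one_sub_inner_ne_zero hw hz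
    have hd := hden z hz
    have e1 := inv_smul_affine_eq hw hz1 P₁ (D + inner ℂ w B)
    have e2 := inv_smul_affine_eq hw hz1 P₂ (Pr B)
    have hz2 : (cayley w (φ z)).1
        = Complex.I / α * ((1 - inner ℂ w z)⁻¹ • (P₁ z + (D + inner ℂ w B))) := by
      have h2 : 1 + inner ℂ w (φ z) = (P₁ z + (D + inner ℂ w B)) / (inner ℂ C z + D) := by
        rw [hφ z hz, inner_smul_right, inner_add_right]
        simp [hP₁]
        field_simp
        ring
      simp only [cayley, h1φ z hz, h2, smul_eq_mul]
      field_simp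
    have hz3 : (cayley w (φ z)).2
        = (Complex.I / α) • ((1 - inner ℂ w z)⁻¹ • (P₂ z + Pr B)) := by
      have h2 : (ℂ ∙ w)ᗮ.orthogonalProjectionOnto (φ z)
          = (inner ℂ C z + D)⁻¹ • (P₂ z + Pr B) := by
        rw [hφ z hz, map_smul, map_add]
        rfl
      simp only [cayley, h1φ z hz, h2, smul_smul]
      congr 1
      field_simp
    ext1
    · rw [hz2, e1, hP₁w]
      simp only [hℓ₀, ha, hb, LinearMap.smul_apply, LinearMap.comp_apply, Submodule.subtype_apply,
        smul_eq_mul]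
      field_simp
      ring_nf
      simp only [Complex.I_sq]
      ring
    · rw [hz3, e2]
      simp only [hk, hM, hc, LinearMap.smul_apply, LinearMap.comp_apply, Submodule.subtype_apply]
      have hI := Complex.I_sq
      match_scalars
      · field_simp
        linear_combination (-(cayley w z).1) * hI
      · field_simp
        linear_combination (-(cayley w z).1) * hI
      · field_simp
        linear_combination (-1 : ℂ) * hI
  have hself : ∀ ζ : ℂ, ∀ ω : (ℂ ∙ w)ᗮ, ‖ω‖ ^ 2 < ζ.im →
      ‖ζ • k + M ω + c‖ ^ 2 < (ℓ₀ * ζ + a ω + b).im := by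
    intro ζ ω h
    have hx : (ζ, ω) ∈ siegelDomain (ℂ ∙ w)ᗮ := h
    have hball := cayleyInv_mem_ball hw hx
    have h1 := cayley_mem_siegelDomain hw (hmap hball)
    rw [hconj _ hball, cayley_cayleyInv hw (lt_of_le_of_lt (sq_nonneg _) h)] at h1
    exact h1
  obtain ⟨hk0, ℓ, hℓ, hℓℓ, -⟩ := affine_selfMap_siegelDomain hself
  have hdℓ : inner ℂ C w + D = ℓ * α := by
    rw [← hℓℓ, hℓ₀]; field_simp
  refine ⟨ℓ, α, b, a, M, c, lt_of_le_of_ne hℓ ?_, hα, hdℓ, h1φ, ?_, ?_⟩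
  · rintro rfl
    exact hdw (by simpa using hdℓ)
  · intro z hz
    rw [hconj z hz, hk0, hℓℓ, smul_zero, zero_add]
  · intro ζ ω h
    have := hself ζ ω h
    rwa [hk0, hℓℓ, smul_zero, zero_add] at this

/-- The boundary dilation coefficient of a linear fractional map whose Cayley conjugate is affine
with dilation `ℓ` is `ℓ⁻¹`. -/
theorem liminf_dilation_eq {φ : V → V} {C : V} {D : ℂ} {w : V} (hw : ‖w‖ = 1)
    {ℓ : ℝ} {α b : ℂ} {a : (ℂ ∙ w)ᗮ →ₗ[ℂ] ℂ} {M : (ℂ ∙ w)ᗮ →ₗ[ℂ] (ℂ ∙ w)ᗮ} {c : (ℂ ∙ w)ᗮ}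
    (hmap : MapsTo φ (Metric.ball 0 1) (Metric.ball 0 1))
    (hℓ : 0 < ℓ) (hα : α ≠ 0) (hd : inner ℂ C w + D = ℓ * α)
    (h1φ : ∀ z ∈ Metric.ball (0 : V) 1, 1 - inner ℂ w (φ z)
        = α * (1 - inner ℂ w z) / (inner ℂ C z + D))
    (hconj : ∀ z ∈ Metric.ball (0 : V) 1, cayley w (φ z)
        = (ℓ * (cayley w z).1 + a (cayley w z).2 + b, M (cayley w z).2 + c))
    (hle : ∀ ω, ‖M ω + c‖ ^ 2 ≤ ℓ * ‖ω‖ ^ 2 + (a ω).im + b.im) :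
    liminf (fun z : V => (((1 - ‖φ z‖ ^ 2) / (1 - ‖z‖ ^ 2) : ℝ) : EReal))
      (𝓝[Metric.ball 0 1] w) = ((ℓ⁻¹ : ℝ) : EReal) := by
  set ρ : ℂ × (ℂ ∙ w)ᗮ → ℝ := fun x => x.1.im - ‖x.2‖ ^ 2 with hρ
  set f : V → ℝ := fun z => ‖α‖ ^ 2 / ‖inner ℂ C z + D‖ ^ 2 with hf
  -- The factor `f` tends to `ℓ⁻²` at `w`, so it remains to see that the ratio of defects has lower
  -- limit `ℓ`.
  have hquot : ∀ z ∈ Metric.ball (0 : V) 1, (1 - ‖φ z‖ ^ 2) / (1 - ‖z‖ ^ 2)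
      = f z * (ρ (cayley w (φ z)) / ρ (cayley w z)) := by
    intro z hz
    have hz1 := one_sub_inner_ne_zero hw hz
    rw [cayley_defect hw hz1, cayley_defect hw (one_sub_inner_ne_zero hw (hmap hz)), h1φ z hz,
      norm_div, norm_mul]
    have : ‖1 - inner ℂ w z‖ ≠ 0 := by simpa using hz1
    simp only [hf, hρ]
    field_simp
  have hftend : Tendsto f (𝓝 w) (𝓝 (ℓ⁻¹ ^ 2)) := by
    have h1 : ℓ⁻¹ ^ 2 = f w := by
      simp only [hf, hd, norm_mul, Complex.norm_real, Real.norm_of_nonneg hℓ.le]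
      have : ‖α‖ ≠ 0 := by simpa using hα
      field_simp
    rw [h1]
    have hc : Continuous fun z : V => ‖inner ℂ C z + D‖ ^ 2 :=
      (((continuous_const.inner continuous_id).add_const D).norm).pow 2
    refine tendsto_const_nhds.div (hc.tendsto w) ?_
    rw [hd]
    have : (ℓ : ℂ) * α ≠ 0 := mul_ne_zero (by exact_mod_cast hℓ.ne') hα
    simpa using this
  set path : ℝ → V := fun t => ((1 - t : ℝ) : ℂ) • w with hpath
  have hpball : ∀ t ∈ Ioo (0 : ℝ) 1, path t ∈ Metric.ball (0 : V) 1 := by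
    intro t ht
    rw [mem_ball_zero_iff, hpath, norm_smul, hw, Complex.norm_real,
      Real.norm_of_nonneg (by linarith [ht.2])]
    linarith [ht.1]
  have hIoo : ∀ᶠ t in 𝓝[>] (0 : ℝ), t ∈ Ioo (0 : ℝ) 1 := Ioo_mem_nhdsGT one_pos
  have hpt : Tendsto path (𝓝[>] 0) (𝓝 w) := by
    have : Continuous path := by fun_prop
    have h := this.tendsto 0
    simp only [hpath, sub_zero, Complex.ofReal_one, one_smul] at h
    exact h.mono_left nhdsWithin_le_nhds
  have hpw : Tendsto path (𝓝[>] 0) (𝓝[Metric.ball 0 1] w) :=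
    tendsto_nhdsWithin_iff.2 ⟨hpt, hIoo.mono hpball⟩
  have : (𝓝[Metric.ball 0 1] w).NeBot := hpw.neBot
  have hℓ2 : ℓ⁻¹ = ℓ⁻¹ ^ 2 * ℓ := by field_simp
  refine le_antisymm ?_ ?_
  -- Upper bound: on the radius to `w`, `ω = 0` and `ζ = i(2 - t)/t`, so the quotient is explicit.
  · have hval : ∀ t ∈ Ioo (0 : ℝ) 1, f (path t) * (ℓ + (b.im - ‖c‖ ^ 2) * (t / (2 - t)))
        = (1 - ‖φ (path t)‖ ^ 2) / (1 - ‖path t‖ ^ 2) := by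
      intro t ht
      rw [hquot _ (hpball t ht), hconj _ (hpball t ht)]
      have hin : inner ℂ w (path t) = ((1 - t : ℝ) : ℂ) := by
        simp only [hpath, inner_smul_right, inner_unit_self hw, mul_one]
      have h1 : (cayley w (path t)).1 = (((2 - t) / t : ℝ) : ℂ) * Complex.I := by
        have ht0 : (t : ℂ) ≠ 0 := by exact_mod_cast ht.1.ne'
        have hsub : (1 : ℂ) - ((1 - t : ℝ) : ℂ) = t := by push_cast; ring
        simp only [cayley, hin, hsub]
        push_cast
        field_simp
        ring
      have h2 : (cayley w (path t)).2 = 0 := by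
        have h : (ℂ ∙ w)ᗮ.orthogonalProjectionOnto w = 0 :=
          Submodule.orthogonalProjectionOnto_apply_of_mem_orthogonal
            (Submodule.le_orthogonal_orthogonal _ (Submodule.mem_span_singleton_self w))
        simp only [cayley, hpath, map_smul, h, smul_zero]
      simp only [hρ, h1, h2, map_zero, zero_add, add_zero, norm_zero]
      have h3 : t ≠ 0 := ht.1.ne'
      have h4 : 2 - t ≠ 0 := by linarith [ht.2]
      simp only [Complex.add_im, Complex.im_ofReal_mul, Complex.I_im, mul_one]
      congr 1
      rw [zero_pow two_ne_zero, sub_zero, eq_div_iff (div_ne_zero h4 h3)]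
      field_simp
      ring
    have hlim : Tendsto (fun t => (1 - ‖φ (path t)‖ ^ 2) / (1 - ‖path t‖ ^ 2)) (𝓝[>] 0)
        (𝓝 ℓ⁻¹) := by
      have h1 : Tendsto (fun t : ℝ => ℓ + (b.im - ‖c‖ ^ 2) * (t / (2 - t))) (𝓝[>] 0)
          (𝓝 (ℓ + (b.im - ‖c‖ ^ 2) * (0 / (2 - 0)))) := by
        refine Tendsto.mono_left ?_ nhdsWithin_le_nhds
        refine tendsto_const_nhds.add (tendsto_const_nhds.mul ?_)
        exact tendsto_id.div (tendsto_const_nhds.sub tendsto_id) (by norm_num)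
      have h2 := (hftend.comp hpt).mul h1
      rw [zero_div, mul_zero, add_zero, ← hℓ2] at h2
      exact h2.congr' (hIoo.mono fun t ht => hval t ht)
    have hlim' : Tendsto ((fun z : V => (((1 - ‖φ z‖ ^ 2) / (1 - ‖z‖ ^ 2) : ℝ) : EReal)) ∘ path)
        (𝓝[>] 0) (𝓝 ((ℓ⁻¹ : ℝ) : EReal)) :=
      (continuous_coe_real_ereal.tendsto _).comp hlim
    refine (liminf_le_liminf_of_le hpw).trans_eq ?_
    rw [← hlim'.liminf_eq]
    rfl
  -- Lower bound: by `hle` the affine map multiplies the defect by at least `ℓ`.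
  · have h1 : Tendsto (fun z => ((f z * ℓ : ℝ) : EReal)) (𝓝[Metric.ball 0 1] w)
        (𝓝 ((ℓ⁻¹ : ℝ) : EReal)) := by
      rw [hℓ2]
      exact (continuous_coe_real_ereal.tendsto _).comp
        ((hftend.mono_left nhdsWithin_le_nhds).mul_const ℓ)
    rw [← h1.liminf_eq]
    refine liminf_le_liminf ?_
    filter_upwards [self_mem_nhdsWithin] with z hz
    rw [EReal.coe_le_coe_iff, hquot z hz, hconj z hz]
    have hpos : 0 < ρ (cayley w z) := sub_pos.2 (cayley_mem_siegelDomain hw hz)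
    refine mul_le_mul_of_nonneg_left ?_ (by simp only [hf]; positivity)
    rw [le_div_iff₀ hpos]
    have := hle (cayley w z).2
    simp only [hρ, Complex.add_im, Complex.im_ofReal_mul]
    linarith

end AffineConjugate

/-! ### Pseudo-inverse conditions on the contractive block -/

section Matrices

/-- If `‖T ω + c‖² - ‖ω‖²` is bounded above, then `c` is orthogonal to the image of every vector
whose norm is preserved by `T`. -/
theorem inner_apply_eq_zero_of_norm_eq {E : Type*} [NormedAddCommGroup E] [InnerProductSpace ℂ E]
    {T : E →ₗ[ℂ] E} {c : E} {β : ℝ} (h : ∀ ω, ‖T ω + c‖ ^ 2 ≤ ‖ω‖ ^ 2 + β) {x : E}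
    (hx : ‖T x‖ = ‖x‖) : inner ℂ (T x) c = 0 := by
  have hre : ∀ y, ‖T y‖ = ‖y‖ → (inner ℂ (T y) c).re = 0 := by
    intro y hy
    -- Along `t y` the quadratic terms cancel, and an affine function of `t` bounded on one side has
    -- slope zero.
    have key : ∀ t : ℝ, 0 ≤ (-2 * (inner ℂ (T y) c).re) * t + β := by
      intro t
      have h1 := h ((t : ℂ) • y)
      rw [map_smul, @norm_add_sq ℂ, inner_smul_left, norm_smul, norm_smul, hy, Complex.conj_ofReal,
        RCLike.re_to_complex, Complex.re_ofReal_mul] at h1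
      nlinarith [sq_nonneg ‖c‖]
    linarith [eq_zero_of_forall_mul_add_nonneg key]
  refine Complex.ext (hre x hx) ?_
  have h1 := hre (Complex.I • x) (by rw [map_smul, norm_smul, norm_smul, hx])
  rw [map_smul, inner_smul_left] at h1
  simpa using h1

variable {r : ℕ}

theorem matVec_eq_toEuclideanLin (A : Matrix (Fin r) (Fin r) ℂ) (x : CSpace r) :
    matVec A x = Matrix.toEuclideanLin A x := rfl

theorem matVec_mul (A B : Matrix (Fin r) (Fin r) ℂ) (x : CSpace r) :
    matVec (A * B) x = matVec A (matVec B x) := by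
  simp [matVec, Matrix.mulVec_mulVec]

theorem matVec_one_sub (A : Matrix (Fin r) (Fin r) ℂ) (x : CSpace r) :
    matVec (1 - A) x = x - matVec A x := by
  ext i
  simp [matVec, Matrix.sub_mulVec]

theorem matVec_zero (A : Matrix (Fin r) (Fin r) ℂ) : matVec A 0 = 0 := by
  rw [matVec_eq_toEuclideanLin, map_zero]

theorem matVec_add (A : Matrix (Fin r) (Fin r) ℂ) (x y : CSpace r) :
    matVec A (x + y) = matVec A x + matVec A y := by
  simp only [matVec_eq_toEuclideanLin, map_add]

theorem matVec_sub (A : Matrix (Fin r) (Fin r) ℂ) (x y : CSpace r) :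
    matVec A (x - y) = matVec A x - matVec A y := by
  simp only [matVec_eq_toEuclideanLin, map_sub]

theorem inner_matVec_left (A : Matrix (Fin r) (Fin r) ℂ) (x y : CSpace r) :
    inner ℂ (matVec A x) y = inner ℂ x (matVec Aᴴ y) := by
  rw [matVec_eq_toEuclideanLin, matVec_eq_toEuclideanLin,
    Matrix.toEuclideanLin_conjTranspose_eq_adjoint, LinearMap.adjoint_inner_right]

theorem norm_matVec_conjTranspose_le {A : Matrix (Fin r) (Fin r) ℂ}
    (hA : ∀ x, ‖matVec A x‖ ≤ ‖x‖) (x : CSpace r) : ‖matVec Aᴴ x‖ ≤ ‖x‖ := by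
  rw [matVec_eq_toEuclideanLin, Matrix.toEuclideanLin_conjTranspose_eq_adjoint]
  exact norm_adjoint_apply_le (T := Matrix.toEuclideanLin A) hA x

theorem inner_self_one_sub_matVec (A : Matrix (Fin r) (Fin r) ℂ) (x : CSpace r) :
    inner ℂ x (matVec (1 - Aᴴ * A) x) = ((‖x‖ ^ 2 - ‖matVec A x‖ ^ 2 : ℝ) : ℂ) := by
  rw [matVec_one_sub, matVec_mul, inner_sub_right, ← inner_matVec_left,
    inner_self_eq_norm_sq_to_K, inner_self_eq_norm_sq_to_K]
  simp

theorem posSemidef_one_sub_of_norm_le {A : Matrix (Fin r) (Fin r) ℂ}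
    (hA : ∀ x, ‖matVec A x‖ ≤ ‖x‖) : (1 - Aᴴ * A).PosSemidef := by
  rw [Matrix.posSemidef_iff_dotProduct_mulVec]
  refine ⟨Matrix.isHermitian_one.sub (Matrix.isHermitian_conjTranspose_mul_self A), fun x => ?_⟩
  have h := inner_self_one_sub_matVec A (WithLp.toLp 2 x)
  rw [EuclideanSpace.inner_eq_star_dotProduct, dotProduct_comm] at h
  change star x ⬝ᵥ (1 - Aᴴ * A) *ᵥ x = _ at h
  rw [h]
  have := pow_le_pow_left₀ (norm_nonneg _) (hA (WithLp.toLp 2 x)) 2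
  exact_mod_cast sub_nonneg.2 this

variable {A : Matrix (Fin r) (Fin r) ℂ} {c : CSpace r} {β : ℝ}

/-- For a contraction `A` such that `‖A x + c‖² ≤ ‖x‖² + β`, the vector `Aᴴ c` lies in the range
of `Q = 1 - Aᴴ A`. -/
theorem matVec_mul_pseudoInv_eq (h : ∀ x, ‖matVec A x + c‖ ^ 2 ≤ ‖x‖ ^ 2 + β) :
    matVec ((1 - Aᴴ * A) * pseudoInv (1 - Aᴴ * A) * Aᴴ) c = matVec Aᴴ c := by
  set Q := 1 - Aᴴ * A with hQ
  have hQh : Qᴴ = Q := (Matrix.isHermitian_one.sub (Matrix.isHermitian_conjTranspose_mul_self A)).eq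
  have hp := isPseudoInverse_pseudoInv Q
  set R := Q * pseudoInv Q with hR
  have hRR : R * R = R := by rw [hR, ← mul_assoc, hp.mul_mul_left]
  have hRh : Rᴴ = R := hp.herm_left.eq
  have hQR : Q * R = Q := by
    have := congrArg Matrix.conjTranspose hp.mul_mul_left
    rwa [Matrix.conjTranspose_mul, hQh, ← hR, hRh] at this
  obtain ⟨v, hv⟩ : ∃ v, v = matVec Aᴴ c := ⟨_, rfl⟩
  rw [matVec_mul, ← hv]
  -- `R` is the orthogonal projection onto the range of `Q`. Since `Q e = 0`, `A` preserves the norm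
  -- of `e`, so `A e ⊥ c` and `e ⊥ v`; also `e ⊥ R v`, hence `e ⊥ e`.
  obtain ⟨e, he⟩ : ∃ e, e = v - matVec R v := ⟨_, rfl⟩
  have hQe : matVec Q e = 0 := by
    rw [he, matVec_sub, ← matVec_mul Q R, hQR, sub_self]
  have hRe : matVec R e = 0 := by
    rw [he, matVec_sub, ← matVec_mul R R, hRR, sub_self]
  have hAe : ‖matVec A e‖ = ‖e‖ := by
    have h1 := inner_self_one_sub_matVec A e
    rw [← hQ, hQe, inner_zero_right] at h1
    have h2 : ‖e‖ ^ 2 - ‖matVec A e‖ ^ 2 = 0 := by exact_mod_cast h1.symm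
    exact (pow_left_inj₀ (norm_nonneg _) (norm_nonneg _) two_ne_zero).1 (sub_eq_zero.1 h2).symm
  have h1 : inner ℂ e v = 0 := by
    rw [hv, ← inner_matVec_left]
    exact inner_apply_eq_zero_of_norm_eq (T := Matrix.toEuclideanLin A) h hAe
  have h2 : inner ℂ e (matVec R v) = 0 := by
    have := inner_matVec_left R e v
    rw [hRh, hRe, inner_zero_left] at this
    exact this.symm
  have h3 : inner ℂ e e = (0 : ℂ) := by
    nth_rw 2 [he]
    rw [inner_sub_right, h1, h2, sub_zero]
  rw [inner_self_eq_zero.1 h3] at he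
  exact (sub_eq_zero.1 he.symm).symm

/-- For a contraction `A` such that `‖A x + c‖² ≤ ‖x‖² + β`, the bound `⟨P⁺ c, c⟩ ≤ β` holds with
`P = 1 - A Aᴴ`. -/
theorem inner_pseudoInv_le (h : ∀ x, ‖matVec A x + c‖ ^ 2 ≤ ‖x‖ ^ 2 + β) :
    (inner ℂ c (matVec (pseudoInv (1 - A * Aᴴ)) c)).re ≤ β := by
  set Q := 1 - Aᴴ * A with hQ
  set P := 1 - A * Aᴴ with hP
  have hPh : Pᴴ = P := (Matrix.isHermitian_one.sub (Matrix.isHermitian_mul_conjTranspose_self A)).eq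
  -- `x` solves `Q x = Aᴴ c`, the critical point equation of `‖A x + c‖² - ‖x‖²`; the hypothesis is
  -- used at this point.
  set x := matVec (pseudoInv Q) (matVec Aᴴ c) with hx
  have hQx : matVec Q x = matVec Aᴴ c := by
    rw [hx, ← matVec_mul, ← matVec_mul, matVec_mul_pseudoInv_eq h]
  have hx1 : x = matVec Aᴴ c + matVec Aᴴ (matVec A x) := by
    rw [hQ, matVec_one_sub, matVec_mul] at hQx
    rw [← hQx, sub_add_cancel]
  -- Since `P y = c`, `⟨P⁺ c, c⟩ = ⟨y, c⟩`, whose real part is the critical value `‖A x + c‖² -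
  -- ‖x‖²`.
  set y := c + matVec A x with hy
  have hPy : matVec P y = c := by
    rw [hP, matVec_one_sub, matVec_mul, hy, matVec_add Aᴴ, ← hx1]
    abel
  have h1 : inner ℂ c (matVec (pseudoInv P) c) = inner ℂ y c := by
    have := inner_matVec_left P y (matVec (pseudoInv P) c)
    rw [hPh, hPy] at this
    rw [this, ← hPy, ← matVec_mul, ← matVec_mul, (isPseudoInverse_pseudoInv P).mul_mul_left]
  have h2 := inner_self_one_sub_matVec A x
  rw [← hQ, hQx, ← inner_matVec_left] at h2
  have h3 := congrArg Complex.re h2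
  rw [Complex.ofReal_re] at h3
  have h4 := h x
  rw [@norm_add_sq ℂ, RCLike.re_to_complex, h3] at h4
  rw [h1, hy, inner_add_left, Complex.add_re, h3, inner_self_eq_norm_sq_to_K]
  have h5 : (((‖c‖ : ℂ)) ^ 2).re = ‖c‖ ^ 2 := by
    rw [← Complex.ofReal_pow, Complex.ofReal_re]
  simp only [Complex.coe_algebraMap, h5]
  linarith

theorem exists_eigenvector_of_mem_spectrum {μ : ℂ} (hμ : μ ∈ spectrum ℂ A) :
    ∃ x : CSpace r, x ≠ 0 ∧ matVec A x = μ • x := by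
  rw [← Matrix.spectrum_toLin', ← Module.End.hasEigenvalue_iff_mem_spectrum] at hμ
  obtain ⟨x, hx⟩ := hμ.exists_hasEigenvector
  refine ⟨WithLp.toLp 2 x, by simpa using hx.2, ?_⟩
  have := hx.apply_eq_smul
  rw [Matrix.toLin'_apply] at this
  rw [matVec, this]
  rfl

end Matrices

/-! ### Block coordinates -/

section Splitting

variable {E : Type*} [NormedAddCommGroup E] [InnerProductSpace ℂ E] {p q r : ℕ}

/-- The coordinates of a vector in an orthonormal basis indexed by three blocks. -/
noncomputable def blockCoord (B : OrthonormalBasis (Fin p ⊕ Fin q ⊕ Fin r) ℂ E) :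
    E ≃ₗ[ℂ] CSpace p × CSpace q × CSpace r where
  toFun ω := (WithLp.toLp 2 fun i => B.repr ω (.inl i),
    WithLp.toLp 2 fun i => B.repr ω (.inr (.inl i)),
    WithLp.toLp 2 fun i => B.repr ω (.inr (.inr i)))
  invFun y := B.repr.symm (WithLp.toLp 2 (Sum.elim y.1 (Sum.elim y.2.1 y.2.2)))
  map_add' x y := by
    ext <;> simp
  map_smul' a x := by
    ext <;> simp
  left_inv ω := by
    refine B.repr.injective ?_
    ext (i | i | i) <;> simp
  right_inv y := by
    ext <;> simp

variable (B : OrthonormalBasis (Fin p ⊕ Fin q ⊕ Fin r) ℂ E)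

/-- The product carries the sup norm, so `blockCoord` is not an isometry; this sum of squares is
what `siegel` refers to. -/
theorem norm_sq_blockCoord (ω : E) :
    ‖(blockCoord B ω).1‖ ^ 2 + ‖(blockCoord B ω).2.1‖ ^ 2 + ‖(blockCoord B ω).2.2‖ ^ 2
      = ‖ω‖ ^ 2 := by
  rw [← B.repr.norm_map ω, EuclideanSpace.norm_sq_eq, EuclideanSpace.norm_sq_eq,
    EuclideanSpace.norm_sq_eq, EuclideanSpace.norm_sq_eq, Fintype.sum_sum_type,
    Fintype.sum_sum_type, add_assoc]
  rfl

/-- A contraction with unimodular eigenvectors in the first two blocks is block diagonal. -/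
theorem blockCoord_apply [FiniteDimensional ℂ E] {T : E →ₗ[ℂ] E} (hT : ∀ x, ‖T x‖ ≤ ‖x‖)
    {μ : Fin q → ℂ} (h₁ : ∀ i, T (B (.inl i)) = B (.inl i))
    (h₂ : ∀ i, T (B (.inr (.inl i))) = μ i • B (.inr (.inl i))) (hμ : ∀ i, ‖μ i‖ = 1) (ω : E) :
    blockCoord B (T ω) = ((blockCoord B ω).1, matVec (Matrix.diagonal μ) (blockCoord B ω).2.1,
      matVec (Matrix.of fun i j => inner ℂ (B (.inr (.inr i))) (T (B (.inr (.inr j)))))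
        (blockCoord B ω).2.2) := by
  have hon := orthonormal_iff_ite.1 B.orthonormal
  ext i
  -- Moving `T` onto the basis vector as `T*` shows that the unimodular rows receive nothing from
  -- other blocks.
  · have h := adjoint_apply_of_unimodular hT (μ := 1) (by simp) (x := B (.inl i)) (by simp [h₁])
    simp only [blockCoord, LinearEquiv.coe_mk, LinearMap.coe_mk, AddHom.coe_mk,
      B.repr_apply_apply]
    rw [← LinearMap.adjoint_inner_left, h]
    simp
  · have h := adjoint_apply_of_unimodular hT (hμ i) (h₂ i)
    simp only [blockCoord, LinearEquiv.coe_mk, LinearMap.coe_mk, AddHom.coe_mk,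
      B.repr_apply_apply, matVec, Matrix.mulVec_diagonal]
    rw [← LinearMap.adjoint_inner_left, h, inner_smul_left]
    simp
  · simp only [blockCoord, LinearEquiv.coe_mk, LinearMap.coe_mk, AddHom.coe_mk,
      matVec, Matrix.mulVec, dotProduct, Matrix.of_apply]
    conv_lhs => rw [← B.sum_repr ω, B.repr_apply_apply]
    simp only [Fintype.sum_sum_type, map_add, map_sum, map_smul, inner_add_right, inner_sum,
      inner_smul_right, h₁, h₂, hon]
    simp [mul_comm]

end Splitting

/-! ### Block normal form of the linear part -/

section NormalForm

variable {E : Type*} [NormedAddCommGroup E] [InnerProductSpace ℂ E] [FiniteDimensional ℂ E]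

/-- Block normal form of the linear part of an affine self-map of the Siegel half-plane of the
shape `(ζ, ω) ↦ (ℓ ζ + b, M ω + c)`. -/
theorem exists_block_normal_form {ℓ β : ℝ} (hℓ : 0 < ℓ) {M : E →ₗ[ℂ] E} {c : E}
    (h : ∀ ω, ‖M ω + c‖ ^ 2 ≤ ℓ * ‖ω‖ ^ 2 + β) :
    ∃ (p q r : ℕ) (B : OrthonormalBasis (Fin p ⊕ Fin q ⊕ Fin r) ℂ E)
      (D : Matrix (Fin q) (Fin q) ℂ) (A : Matrix (Fin r) (Fin r) ℂ) (c' : CSpace r),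
      (∀ ω, blockCoord B (M ω + c) = ((√ℓ : ℂ) • (blockCoord B ω).1,
        (√ℓ : ℂ) • matVec D (blockCoord B ω).2.1,
        (√ℓ : ℂ) • matVec A (blockCoord B ω).2.2 + c')) ∧
      D.IsDiag ∧ spectrum ℂ D ⊆ Metric.sphere 0 1 \ {1} ∧
      (∀ μ ∈ spectrum ℂ A, ‖μ‖ < 1) ∧ (∀ x, ‖matVec A x‖ ≤ ‖x‖) ∧
      ∀ x, ‖matVec A x + c'‖ ^ 2 ≤ ‖x‖ ^ 2 + β := by
  have hs : 0 < √ℓ := Real.sqrt_pos.2 hℓ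
  have hsq : √ℓ ^ 2 = ℓ := Real.sq_sqrt hℓ.le
  have hs0 : (√ℓ : ℂ) ≠ 0 := by exact_mod_cast hs.ne'
  set T : E →ₗ[ℂ] E := (√ℓ : ℂ)⁻¹ • M with hT
  have hMT : ∀ ω, M ω = (√ℓ : ℂ) • T ω := fun ω => by
    simp [hT, smul_smul, hs0]
  have hTc : ∀ ω, ‖T ω + c‖ ^ 2 ≤ ‖ω‖ ^ 2 + β := by
    intro ω
    have h1 := h ((√ℓ : ℂ)⁻¹ • ω)
    rw [map_smul, norm_smul, norm_inv, Complex.norm_real, Real.norm_of_nonneg hs.le, mul_pow,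
      inv_pow, hsq, ← mul_assoc, mul_inv_cancel₀ hℓ.ne', one_mul] at h1
    exact h1
  have hTn : ∀ ω, ‖T ω‖ ≤ ‖ω‖ := by
    intro ω
    -- The choice `b = βi` makes `Im b = β`.
    have h1 := norm_sq_linear_le (a := (0 : E →ₗ[ℂ] ℂ)) (b := (β : ℂ) * Complex.I) (ℓ := 1)
      (M := T) (c := c) (by simpa using hTc) ω
    rw [one_mul] at h1
    exact (pow_le_pow_iff_left₀ (norm_nonneg _) (norm_nonneg _) two_ne_zero).1 h1
  obtain ⟨p, q, r, B, μ, h₁, h₂, hμ, hmax⟩ := exists_orthonormalBasis_splitting hTn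
  set A : Matrix (Fin r) (Fin r) ℂ :=
    Matrix.of fun i j => inner ℂ (B (.inr (.inr i))) (T (B (.inr (.inr j)))) with hA
  have hblock := blockCoord_apply B hTn h₁ h₂ (fun i => (hμ i).1)
  rw [← hA] at hblock
  have hc1 : ∀ i, inner ℂ (B (.inl i)) c = 0 := by
    intro i
    have := inner_apply_eq_zero_of_norm_eq hTc (x := B (.inl i)) (by rw [h₁])
    rwa [h₁] at this
  have hc2 : ∀ i, inner ℂ (B (.inr (.inl i))) c = 0 := by
    intro i
    have := inner_apply_eq_zero_of_norm_eq hTc (x := B (.inr (.inl i)))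
      (by rw [h₂, norm_smul, (hμ i).1, one_mul])
    rw [h₂, inner_smul_left, mul_eq_zero] at this
    refine this.resolve_left fun h0 => ?_
    have h1 := (hμ i).1
    rw [← RCLike.norm_conj, h0, norm_zero] at h1
    exact zero_ne_one h1
  have hcB : blockCoord B c = (0, 0, (blockCoord B c).2.2) := by
    ext i
    · simpa [blockCoord, B.repr_apply_apply] using hc1 i
    · simpa [blockCoord, B.repr_apply_apply] using hc2 i
    · rfl
  have hlift : ∀ x : CSpace r, ∃ ω : E, blockCoord B ω = (0, 0, x) ∧ ‖ω‖ = ‖x‖ := by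
    intro x
    refine ⟨(blockCoord B).symm (0, 0, x), by simp, ?_⟩
    have := norm_sq_blockCoord B ((blockCoord B).symm (0, 0, x))
    rw [LinearEquiv.apply_symm_apply] at this
    simpa using this.symm
  have hTlift : ∀ (x : CSpace r) (ω : E), blockCoord B ω = (0, 0, x) →
      blockCoord B (T ω) = (0, 0, matVec A x) := by
    intro x ω hω
    rw [hblock, hω, matVec_zero]
  refine ⟨p, q, r, B, Matrix.diagonal μ, A, (blockCoord B c).2.2, ?_, Matrix.isDiag_diagonal μ,
    ?_, ?_, ?_, ?_⟩
  · intro ω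
    rw [map_add, hMT, map_smul, hblock, hcB]
    ext <;> simp
  · rw [spectrum_diagonal]
    rintro _ ⟨i, rfl⟩
    exact ⟨by simpa using (hμ i).1, (hμ i).2⟩
  -- An eigenvector of `A` lifts to an eigenvector of `T` orthogonal to the first two blocks, where
  -- maximality gives `‖ν‖ < 1`.
  · intro ν hν
    obtain ⟨x, hx0, hx⟩ := exists_eigenvector_of_mem_spectrum hν
    obtain ⟨ω, hω, hn⟩ := hlift x
    refine hmax ω ν ?_ ?_ ?_ ?_
    · rw [← norm_ne_zero_iff, hn]
      exact norm_ne_zero_iff.2 hx0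
    · intro i
      simpa [blockCoord, B.repr_apply_apply] using congrArg (fun y => y.1 i) hω
    · intro i
      simpa [blockCoord, B.repr_apply_apply] using congrArg (fun y => y.2.1 i) hω
    · refine (blockCoord B).injective ?_
      rw [hTlift x ω hω, map_smul, hω, hx]
      simp
  · intro x
    obtain ⟨ω, hω, hn⟩ := hlift x
    have h1 := norm_sq_blockCoord B (T ω)
    rw [hTlift x ω hω] at h1
    simp only [norm_zero, ne_eq, OfNat.ofNat_ne_zero, not_false_eq_true, zero_pow, zero_add] at h1
    rw [(pow_left_inj₀ (norm_nonneg _) (norm_nonneg _) two_ne_zero).1 h1, ← hn]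
    exact hTn ω
  · intro x
    obtain ⟨ω, hω, hn⟩ := hlift x
    have h1 := norm_sq_blockCoord B (T ω + c)
    rw [map_add, hTlift x ω hω, hcB] at h1
    simp only [Prod.mk_add_mk, add_zero, norm_zero, ne_eq, OfNat.ofNat_ne_zero, not_false_eq_true,
      zero_pow, zero_add] at h1
    rw [h1, ← hn]
    exact hTc ω

theorem exists_continuousLinearEquiv_eq {F : Type*} [NormedAddCommGroup F] [NormedSpace ℂ F]
    (e : E ≃ₗ[ℂ] F) : ∃ S : E ≃L[ℂ] F, ∀ x, S x = e x :=
  have := e.finiteDimensional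
  ⟨e.toContinuousLinearEquiv, fun _ => rfl⟩

end NormalForm

/-! ### Assembly of the conjugation -/

theorem mainTheorem10 (N : ℕ) (φ : CSpace N → CSpace N) (hφ : IsLFTBall φ)
    (hyp : IsHyperbolicMap φ) :
    ∃ (p q r : ℕ) (ℓ : ℝ) (b : ℂ) (D : Matrix (Fin q) (Fin q) ℂ)
      (A : Matrix (Fin r) (Fin r) ℂ) (c : CSpace r),
      1 + p + q + r = N ∧
      1 < ℓ ∧ HasBoundaryDilation φ ℓ⁻¹ ∧
      MapsTo (hyperbolicForm ℓ b D A c) (siegel p q r) (siegel p q r) ∧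
      AreConjugate φ (unitBall N) (hyperbolicForm ℓ b D A c) (siegel p q r) ∧
      D.IsDiag ∧ spectrum ℂ D ⊆ Metric.sphere 0 1 \ {1} ∧
      (∀ μ ∈ spectrum ℂ A, ‖μ‖ < 1) ∧
      (1 - Aᴴ * A).PosSemidef ∧ (1 - A * Aᴴ).PosSemidef ∧
      (inner ℂ c (matVec (pseudoInv (1 - A * Aᴴ)) c)).re ≤ b.im ∧
      matVec ((1 - Aᴴ * A) * pseudoInv (1 - Aᴴ * A) * Aᴴ) c = matVec Aᴴ c := by

  obtain ⟨hmap, A₀, B, C, D₀, hA₀⟩ := hφ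
  obtain ⟨hfix, δ, ⟨hδ0, hδ1⟩, w, hDW, hlim⟩ := hyp
  have hw : ‖w‖ = 1 := hDW.1
  have hden : ∀ z ∈ Metric.ball (0 : CSpace N) 1, inner ℂ C z + D₀ ≠ 0 := fun z hz => (hA₀ z hz).1
  have hφ : ∀ z ∈ Metric.ball (0 : CSpace N) 1,
      φ z = (inner ℂ C z + D₀)⁻¹ • (Matrix.toEuclideanLin A₀ z + B) := fun z hz => (hA₀ z hz).2
  have horbit : Tendsto (fun n => φ^[n] 0) atTop (𝓝 w) :=
    (hDW.2 {0} (by simp [unitBall]) isCompact_singleton).tendsto_at (mem_singleton 0)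
  have hdw := denominator_ne_zero_of_mem_sphere hmap hden hφ hfix hw
  have hFw := numerator_eq_of_tendsto_iterate hmap hφ horbit hdw
  obtain ⟨ℓ, α, b₀, a, M, c₀, hℓ, hα, hd, h1φ, hconj, hself⟩ :=
    exists_affine_conjugate hmap hden hφ hw hdw hFw
  have hle : ∀ ω, ‖M ω + c₀‖ ^ 2 ≤ ℓ * ‖ω‖ ^ 2 + (a ω).im + b₀.im := by
    obtain ⟨-, ℓ', -, h2, h3⟩ := affine_selfMap_siegelDomain (k := 0) (ℓ₀ := ℓ) (b := b₀)
      (a := a) (M := M) (c := c₀) (by simpa using hself)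
    obtain rfl : ℓ = ℓ' := by exact_mod_cast h2
    exact h3
  have hδ : δ = ℓ⁻¹ := by
    have := liminf_dilation_eq hw hmap hℓ hα hd h1φ hconj hle
    exact EReal.coe_injective (hlim.symm.trans this)
  subst hδ
  have hℓ1 : 1 < ℓ := (inv_lt_one₀ hℓ).1 hδ1
  obtain ⟨γ, b, c', hheis, hineq⟩ := exists_heisenberg_normalization hℓ1 hself
  obtain ⟨p, q, r, 𝓑, D, A, c, hblock, hDdiag, hDspec, hAspec, hAn, hAc⟩ :=
    exists_block_normal_form hℓ hineq
  obtain ⟨S, hS⟩ := exists_continuousLinearEquiv_eq (blockCoord 𝓑)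
  simp only [← hS] at hblock
  -- By `hheis` the normalized map is the affine one conjugated by `heisenberg γ`, so `σ` applies
  -- `heisenberg (-γ)` after the Cayley transform.
  set σ : CSpace N → ℂ × CSpace p × CSpace q × CSpace r := fun z =>
    ((heisenberg (-γ) (cayley w z)).1, S (heisenberg (-γ) (cayley w z)).2) with hσ
  set τ : ℂ × CSpace p × CSpace q × CSpace r → CSpace N := fun x =>
    cayleyInv w (heisenberg γ (x.1, S.symm x.2)) with hτ
  have hnormS : ∀ ω, ‖(S ω).1‖ ^ 2 + ‖(S ω).2.1‖ ^ 2 + ‖(S ω).2.2‖ ^ 2 = ‖ω‖ ^ 2 :=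
    fun ω => by simpa only [hS] using norm_sq_blockCoord 𝓑 ω
  have hdom : ∀ x ∈ siegel p q r, heisenberg γ (x.1, S.symm x.2) ∈ siegelDomain (ℂ ∙ w)ᗮ := by
    intro x hx
    rw [heisenberg_mem_iff, siegelDomain, mem_ofPred_eq, ← hnormS, S.apply_symm_apply]
    exact hx
  have hσmaps : MapsTo σ (unitBall N) (siegel p q r) := by
    intro z hz
    have h1 := (heisenberg_mem_iff (-γ) _).2 (cayley_mem_siegelDomain hw hz)
    rw [siegelDomain, mem_ofPred_eq, ← hnormS] at h1
    exact h1
  have hτmaps : MapsTo τ (siegel p q r) (unitBall N) := fun x hx => cayleyInv_mem_ball hw (hdom x hx)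
  have hcτ : ∀ x ∈ siegel p q r, cayley w (τ x) = heisenberg γ (x.1, S.symm x.2) := fun x hx =>
    cayley_cayleyInv hw (lt_of_le_of_lt (sq_nonneg _) (hdom x hx))
  have hform : ∀ x ∈ siegel p q r, hyperbolicForm ℓ b D A c x = σ (φ (τ x)) := by
    intro x hx
    have h1 : cayley w (φ (τ x)) = heisenberg γ (ℓ * x.1 + b, M (S.symm x.2) + c') := by
      rw [hconj _ (hτmaps hx), hcτ x hx, hheis]
    have h2 := hblock (S.symm x.2)
    rw [S.apply_symm_apply] at h2
    simp only [hσ, h1, heisenberg_neg_heisenberg, h2]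
    rfl
  refine ⟨p, q, r, ℓ, b, D, A, c, ?_, hℓ1, ⟨w, hDW, hlim⟩, ?_, ?_, hDdiag, hDspec, hAspec,
    posSemidef_one_sub_of_norm_le hAn, ?_, inner_pseudoInv_le hAc, matVec_mul_pseudoInv_eq hAc⟩
  -- `p + q + r` is the dimension of the orthogonal complement of the line through `w`.
  · have h1 := Module.finrank_eq_card_basis 𝓑.toBasis
    have hw0 : w ≠ 0 := by rw [← norm_ne_zero_iff, hw]; exact one_ne_zero
    have h2 := (ℂ ∙ w).finrank_add_finrank_orthogonal
    rw [finrank_span_singleton hw0, h1, finrank_euclideanSpace_fin] at h2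
    simp only [Fintype.card_sum, Fintype.card_fin] at h2
    omega
  · intro x hx
    rw [hform x hx]
    exact hσmaps (hmap (hτmaps hx))
  · refine ⟨σ, τ, ?_, ?_, hσmaps, hτmaps, ?_, ?_, hform⟩
    · have h1 := (differentiable_heisenberg (-γ)).comp_differentiableOn (differentiableOn_cayley hw)
      exact h1.fst.prodMk (S.differentiable.comp_differentiableOn h1.snd)
    · refine (differentiableOn_cayleyInv w).comp ?_ hdom
      refine ((differentiable_heisenberg γ).comp ?_).differentiableOn
      exact differentiable_fst.prodMk (S.symm.differentiable.comp differentiable_snd)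
    · intro z hz
      simp only [hσ, hτ, S.symm_apply_apply, Prod.mk.eta, heisenberg_heisenberg_neg]
      exact cayleyInv_cayley hw hz
    · intro x hx
      simp only [hσ, hcτ x hx, heisenberg_neg_heisenberg, S.apply_symm_apply]
  · have := posSemidef_one_sub_of_norm_le (norm_matVec_conjTranspose_le hAn)
    rwa [Matrix.conjTranspose_conjTranspose] at this
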